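/- **Setting.** Let $X$ and $U$ be real Hilbert spaces, let $A:D(A)\subset X\to X$ generate a $C_0$-semigroup $\{S(t)\}_{t\ge 0}$ on $X$, let $X_{-1}=D(A^*)'$ be the dual of $D(A^*)$ (with the graph norm) with respect to the pivot space $X$, and let $S_{-1}(t)$ be the extension of $S(t)$ to $X_{-1}$. Let $B\in\mathcal L(U,X_{-1})$, $B\neq 0$, be an admissible control operator: for each $t>0$ there is $C>0$ with $\int_0^{t}S_{-1}(t-\tau)Bu(\tau)\,d\tau\in X$ and $\big\|\int_0^{t}S_{-1}(t-\tau)Bu(\tau)\,d\tau\big\|_X\le C\|u\|_{L^2(0,t;U)}$ for all $u\in L^2_{loc}(\mathbb R^+;U)$. For $y_0\in X$, $T>0$ and $v\in L^2(0,T;U)$, let $\hat y(\cdot;y_0,v)\in C([0,T];X)$ be the solution of $y'=Ay+Bv$, $y(0)=y_0$, i.e. $\langle \hat y(t),z\rangle_X-\langle y_0,S^*(t)z\rangle_X=\int_0^t\langle v(s),B^*S^*(t-s)z\rangle_U\,ds$ for all $z\in D(A^*)$ and $t\in[0,T]$; for $u\in L^\infty(\mathbb R^+;U)$ let $y(\cdot;y_0,u)\in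 C(\mathbb R^+;X)$ be the function whose restriction to each $[0,T]$ is the solution with control $u|_{(0,T)}$. **Minimal time problem.** For $M\in(0,\infty)$ and $y_0\in X\setminus\{0\}$, let $\mathcal U^M$ be the set of strongly measurable $u:\mathbb R^+\to U$ with $\|u(t)\|_U\le M$ for a.e. $t$. An admissible control to $(TP)^{M,y_0}$ is a $u\in\mathcal U^M$ with $y(\hat t;y_0,u)=0$ for some $\hat t\in(0,\infty)$; $T(M,y_0)$ is the infimum of all such $\hat t$ ($\infty$ if there is none). A minimal time control is a $u^*\in\mathcal U^M$ such that $T(M,y_0)<\infty$, $y(T(M,y_0);y_0,u^*)=0$ and $u^*=0$ a.e. on $(T(M,y_0),\infty)$. The bang-bang property of $(TP)^{M,y_0}$ means that there is an admissible control and each minimal time control $u^*$ satisfies $\|u^*(t)\|_U=M$ for a.e. $t\in(0,T(M,y_0))$. **Minimal norm problem.** For $T\in(0,\infty)$ and $y_0\in X\setminus\{0\}$, an admissible control to $(NP)^{T,y_0}$ is a $v\in L^\infty(0,T;U)$ with $\hat y(T;y_0,v)=0$; $N(T,y_0)$ is the infimum of $\|v\|_{L^\infty(0,T;U)}$ over these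 $v$ ($\infty$ if there is none). A minimal norm control is an admissible $v^*$ with $\|v^*\|_{L^\infty(0,T;U)}=N(T,y_0)$. The bang-bang property of $(NP)^{T,y_0}$ means that there is an admissible control and each minimal norm control $v^*$ satisfies $\|v^*(t)\|_U=N(T,y_0)$ for a.e. $t\in(0,T)$. Since $N(\cdot,y_0)$ is decreasing, put $N(0,y_0)=\lim_{t\to0^+}N(t,y_0)$ and $N(\infty,y_0)=\lim_{t\to\infty}N(t,y_0)$. **Sets.** Let $T^0(y_0)=\inf\{t\ge0:\exists u\in L^\infty(\mathbb R^+;U),\ y(t;y_0,u)=0\}$ and $T^1(y_0)=\inf\{t\ge0:S(t)y_0=0\}$, with $\inf\emptyset=\infty$. Write $N_0(y_0)=N(T^0(y_0),y_0)$ and $N_1(y_0)=N(T^1(y_0),y_0)$. Let $\mathcal W=\{(T,y_0):0<T<\infty,\ y_0\in X\setminus\{0\}\}$, $\mathcal V=\{(M,y_0):0<M<\infty,\ y_0\in X\setminus\{0\}\}$, and - $\mathcal W_{2,2}=\{(T,y_0)\in\mathcal W:0<N_0(y_0)<\infty,\ T=T^0(y_0)\}$, - $\mathcal W_{3,2}=\{(T,y_0)\in\mathcal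 W:N_0(y_0)=\infty,\ T^0(y_0)<\infty,\ T^0(y_0)<T<T^1(y_0)\}$, - $\mathcal W_{3,3}=\{(T,y_0)\in\mathcal W:N_0(y_0)=\infty,\ T^0(y_0)<\infty,\ T^0(y_0)<T,\ T\ge T^1(y_0)\}$, - $\mathcal V_{2,3}=\{(M,y_0)\in\mathcal V:0<N_0(y_0)<\infty,\ N_1(y_0)<M,\ M=N_0(y_0)\}$, - $\mathcal V_{3,1}=\{(M,y_0)\in\mathcal V:N_0(y_0)=\infty,\ T^0(y_0)<\infty,\ M\le N_1(y_0)\}$, - $\mathcal V_{3,2}=\{(M,y_0)\in\mathcal V:N_0(y_0)=\infty,\ T^0(y_0)<\infty,\ M>N_1(y_0)\}$, - $\gamma_1=\{(T^0(y_0),y_0)\in\mathcal W:0<N_0(y_0)<\infty\}$, - $\gamma_2=\{(N_0(y_0),y_0)\in\mathcal V:0<N_0(y_0)<\infty,\ N_0(y_0)\ne N_1(y_0)\}$. **Assumptions.** (H3): for each $T\in(0,\infty)$ there is $C>0$ with $\|S^*(T)z\|_X\le C\int_0^T\|B^*S^*(T-t)z\|_U\,dt$ for all $z\in D(A^*)$.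 (H4): for all $z\in X$, $T\in(0,\infty)$ and measurable $E\subset(0,T)$ of positive measure, if $\widetilde{B^*S^*}(T-\cdot)z=0$ a.e. on $E$, then $\widetilde{B^*S^*}(T-\cdot)z=0$ a.e. on $(0,T)$, where $\widetilde{B^*S^*}(T-\cdot):X\to L^2(0,T;U)$ is the continuous extension of $B^*S^*(T-\cdot):D(A^*)\to L^2(0,T;U)$. **Theorem.** (i) If (H3) holds, then $\mathcal W=\mathcal W_{3,2}\cup\mathcal W_{3,3}$ and $\mathcal V=\mathcal V_{3,1}\cup\mathcal V_{3,2}$; in particular $\gamma_1=\mathcal W_{2,2}=\emptyset$ and $\gamma_2=\mathcal V_{2,3}=\emptyset$. (ii) If (H3) holds, then for each $(M,y_0)\in\mathcal V_{3,1}$ the problem $(TP)^{M,y_0}$ has no admissible control and does not have the bang-bang property. If (H3) and (H4) hold, then for each $(M,y_0)\in\mathcal V_{3,2}$ the problem $(TP)^{M,y_0}$ has the bang-bang property. (iii) For each $(T,y_0)\in\mathcal W_{3,3}$ (without assuming (H3) or (H4)) the null control is the unique minimal norm control to $(NP)^{T,y_0}$, and this problem has the bang-bang property. If (H3) and (H4)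 hold, then for each $(T,y_0)\in\mathcal W_{3,2}$ the problem $(NP)^{T,y_0}$ has the bang-bang property and the null control is not a minimal norm control to it. -/

import Mathlib

open MeasureTheory Filter Set
open scoped ENNReal NNReal Topology

noncomputable section

/-- A `C₀`-semigroup `{S(t)}_{t ≥ 0}` of bounded linear operators on a real normed space `X`. -/
structure C0Semigroup (X : Type*) [NormedAddCommGroup X] [NormedSpace ℝ X] where
  /-- The operator `S(t)`. -/
  op : ℝ≥0 → X →L[ℝ] X
  op_zero : op 0 = ContinuousLinearMap.id ℝ X
  op_add : ∀ s t : ℝ≥0, op (s + t) = (op s).comp (op t)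
  tendsto_op : ∀ x : X, Tendsto (fun t => op t x) (𝓝[>] 0) (𝓝 x)

namespace C0Semigroup

section Generator

variable {X : Type*} [NormedAddCommGroup X] [NormedSpace ℝ X] (S : C0Semigroup X)

/-- `y` is the derivative at `0⁺` of `t ↦ S(t) x`. -/
def HasGen (x y : X) : Prop :=
  Tendsto (fun t : ℝ≥0 => (t : ℝ)⁻¹ • (S.op t x - x)) (𝓝[>] 0) (𝓝 y)

theorem HasGen.unique {x y y' : X} (h : S.HasGen x y) (h' : S.HasGen x y') : y = y' :=
  tendsto_nhds_unique h h'

theorem HasGen.add {x y x' y' : X} (h : S.HasGen x y) (h' : S.HasGen x' y') :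
    S.HasGen (x + x') (y + y') := by
  refine (Tendsto.add h h').congr fun t => ?_
  rw [← smul_add, map_add]
  congr 1
  abel

theorem HasGen.smul {x y : X} (c : ℝ) (h : S.HasGen x y) : S.HasGen (c • x) (c • y) := by
  refine (Tendsto.const_smul h c).congr fun t => ?_
  rw [map_smul, ← smul_sub, smul_comm]

theorem HasGen.zero : S.HasGen 0 0 := by
  simp [HasGen]

/-- The (infinitesimal) generator `A : D(A) ⊂ X → X` of the semigroup: `D(A)` is the set of the `x`
for which `lim_{t → 0⁺} (S(t) x - x) / t` exists, and `A x` is this limit. -/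
def generator : X →ₗ.[ℝ] X where
  domain :=
    { carrier := {x | ∃ y, S.HasGen x y}
      add_mem' := fun ⟨_, h⟩ ⟨_, h'⟩ => ⟨_, HasGen.add S h h'⟩
      zero_mem' := ⟨0, HasGen.zero S⟩
      smul_mem' := fun c _ ⟨_, h⟩ => ⟨_, HasGen.smul S c h⟩ }
  toFun :=
    { toFun := fun x => x.2.choose
      map_add' := fun x x' => HasGen.unique S (x + x').2.choose_spec
        (HasGen.add S x.2.choose_spec x'.2.choose_spec)
      map_smul' := fun c x => HasGen.unique S (c • x).2.choose_spec
        (HasGen.smul S c x.2.choose_spec) }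

theorem hasGen_generator (x : S.generator.domain) : S.HasGen x (S.generator x) :=
  x.2.choose_spec

theorem HasGen.op {x y : X} (h : S.HasGen x y) (s : ℝ≥0) : S.HasGen (S.op s x) (S.op s y) := by
  refine (((S.op s).continuous.tendsto y).comp h).congr fun t => ?_
  have e : S.op t (S.op s x) = S.op s (S.op t x) := by
    rw [← ContinuousLinearMap.comp_apply, ← S.op_add, add_comm, S.op_add,
      ContinuousLinearMap.comp_apply]
  simp [e, map_sub]

end Generator

variable {X : Type*} [NormedAddCommGroup X] [InnerProductSpace ℝ X] [CompleteSpace X]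
variable {U : Type*} [NormedAddCommGroup U] [InnerProductSpace ℝ U] [CompleteSpace U]
variable (S : C0Semigroup X)

/-- `S*(t)`, the Hilbert space adjoint of `S(t)`. -/
def adjOp (t : ℝ≥0) : X →L[ℝ] X := ContinuousLinearMap.adjoint (S.op t)

/-- The space `D(A*)`, where `A*` is the Hilbert space adjoint of the generator `A`, with the graph
norm: it is realized as the graph of `A*`, i.e. its elements are the pairs `(z, A* z)` with
`z ∈ D(A*)`, normed by `max ‖z‖ ‖A* z‖`. -/
abbrev DAdj : Type _ := ↥(S.generator.adjoint.graph)

/-- The inclusion of `D(A*)` into `X`. -/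
def incl : S.DAdj →L[ℝ] X :=
  (ContinuousLinearMap.fst ℝ X X).comp S.generator.adjoint.graph.subtypeL

theorem adjOp_mem_graph (t : ℝ≥0) (p : X × X) (hp : p ∈ S.generator.adjoint.graph) :
    (S.adjOp t).prodMap (S.adjOp t) p ∈ S.generator.adjoint.graph := by
  obtain ⟨z, hz, hz'⟩ := (LinearPMap.mem_graph_iff _).1 hp
  by_cases hd : Dense (S.generator.domain : Set X)
  · have key : ∀ x : S.generator.domain,
        inner ℝ (S.adjOp t (S.generator.adjoint z)) (x : X)
          = inner ℝ (S.adjOp t (z : X)) (S.generator x) := by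
      intro x
      have hx := HasGen.op S (S.hasGen_generator x) t
      let x' : S.generator.domain := ⟨S.op t x, _, hx⟩
      have hx' : S.generator x' = S.op t (S.generator x) :=
        HasGen.unique S (S.hasGen_generator x') hx
      have := LinearPMap.adjoint_isFormalAdjoint hd z x'
      rw [hx'] at this
      simpa [adjOp, ContinuousLinearMap.adjoint_inner_left, x'] using this
    have hm : S.adjOp t (z : X) ∈ S.generator.adjoint.domain :=
      LinearPMap.mem_adjoint_domain_of_exists _ ⟨_, key⟩
    refine (LinearPMap.mem_graph_iff _).2 ⟨⟨_, hm⟩, by simp [← hz], ?_⟩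
    rw [LinearPMap.adjoint_apply_eq hd ⟨_, hm⟩ key]
    simp [← hz']
  · have hm : S.adjOp t (z : X) ∈ S.generator.adjoint.domain := by
      refine (LinearPMap.mem_adjoint_domain_iff _ _).2 ?_
      have hc := (LinearPMap.mem_adjoint_domain_iff _ _).1 z.2
      let f : S.generator.domain →L[ℝ] S.generator.domain :=
        ((S.op t).comp S.generator.domain.subtypeL).codRestrict S.generator.domain
          fun x => ⟨_, HasGen.op S (S.hasGen_generator x) t⟩
      refine (hc.comp f.continuous).congr fun x => ?_
      have hx : S.generator (f x) = S.op t (S.generator x) :=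
        HasGen.unique S (S.hasGen_generator (f x)) (HasGen.op S (S.hasGen_generator x) t)
      have : S.generator.toFun (f x) = S.op t (S.generator.toFun x) := hx
      simp [adjOp, ContinuousLinearMap.adjoint_inner_left, this]
    refine (LinearPMap.mem_graph_iff _).2 ⟨⟨_, hm⟩, by simp [← hz], ?_⟩
    rw [LinearPMap.adjoint_apply_of_not_dense hd]
    simp [← hz', LinearPMap.adjoint_apply_of_not_dense hd]

/-- `S*(t)` as a bounded operator on `D(A*)`. -/
def adjD (t : ℝ≥0) : S.DAdj →L[ℝ] S.DAdj :=
  (((S.adjOp t).prodMap (S.adjOp t)).comp S.generator.adjoint.graph.subtypeL).codRestrict _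
    fun z => S.adjOp_mem_graph t z z.2

/-- The extrapolation space `X_{-1} = D(A*)'`, the dual of `D(A*)`. -/
abbrev Xneg : Type _ := StrongDual ℝ S.DAdj

/-- The embedding `X ⊂ X_{-1}` that comes from the pivot space `X`: `x ↦ ⟨x, ·⟩_X`. -/
def emb (x : X) : S.Xneg := (innerSL ℝ x).comp S.incl

/-- The extension `S_{-1}(t)` of `S(t)` to `X_{-1}`, i.e. the dual operator of `S*(t)` on `D(A*)`. -/
def opNeg (t : ℝ≥0) : S.Xneg →L[ℝ] S.Xneg :=
  (ContinuousLinearMap.compL ℝ S.DAdj S.DAdj ℝ).flip (S.adjD t)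

/-- `S_{-1}(t)` extends `S(t)`. -/
theorem opNeg_emb (t : ℝ≥0) (x : X) : S.opNeg t (S.emb x) = S.emb (S.op t x) := by
  ext z
  exact ContinuousLinearMap.adjoint_inner_right (S.op t) x _

variable {S} (B : U →L[ℝ] S.Xneg)

/-- `B* : D(A*) → U`, the adjoint of `B ∈ L(U, X_{-1})`; see `inner_adjB`. -/
def adjB (z : S.DAdj) : U := (InnerProductSpace.toDual ℝ U).symm (B.flip z)

theorem inner_adjB (z : S.DAdj) (w : U) : inner ℝ (adjB B z) w = B w z := by
  simp [adjB]

/-- The function `t ↦ B* S*(T - t) z`, for `z ∈ D(A*)`; only `t ∈ [0, T]` matters. -/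
def obs (T : ℝ≥0) (z : S.DAdj) (t : ℝ) : U := adjB B (S.adjD ((T : ℝ) - t).toNNReal z)

/-- Lebesgue measure on the interval `(0, T)`. -/
def vol (T : ℝ≥0) : Measure ℝ := volume.restrict (Ioo 0 (T : ℝ))

/-- Lebesgue measure on the half line `(0, ∞)`. -/
def volPos : Measure ℝ := volume.restrict (Ioi 0)

/-- `B` is an admissible control operator for `S`: for each `t > 0` there is `C > 0` such that, for
all `u ∈ L²_loc(ℝ⁺; U)`, the element `∫₀ᵗ S_{-1}(t - τ) B u(τ) dτ` of `X_{-1}` lies in `X`, with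
`X`-norm at most `C ‖u‖_{L²(0,t;U)}`. -/
def Admissible : Prop :=
  ∀ t : ℝ≥0, 0 < t → ∃ C : ℝ, 0 < C ∧
    ∀ u : ℝ → U, (∀ T : ℝ≥0, MemLp u 2 (vol T)) →
      ∃ x : X, S.emb x = ∫ τ, S.opNeg ((t : ℝ) - τ).toNNReal (B (u τ)) ∂(vol t) ∧
        ‖x‖ ≤ C * (eLpNorm u 2 (vol t)).toReal

/-! ### Solutions of the controlled equation -/

/-- `y ∈ C([0,T]; X)` is the solution of `y' = A y + B v` on `(0, T]`, `y(0) = y₀`: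
`⟨y(t), z⟩ - ⟨y₀, S*(t) z⟩ = ∫₀ᵗ ⟨v(s), B* S*(t - s) z⟩ ds` for all `z ∈ D(A*)`, `t ∈ [0, T]`. -/
def IsSolOn (T : ℝ≥0) (y₀ : X) (v : ℝ → U) (y : ℝ≥0 → X) : Prop :=
  ContinuousOn y (Icc 0 T) ∧
    ∀ z : S.DAdj, ∀ t : ℝ≥0, t ≤ T →
      inner ℝ (y t) (S.incl z) - inner ℝ y₀ (S.adjOp t (S.incl z))
        = ∫ s, inner ℝ (v s) (obs B t z s) ∂(vol t)

/-- `y ∈ C(ℝ⁺; X)` is the solution of `y' = A y + B u` on `(0, ∞)`, `y(0) = y₀`. -/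
def IsSol (y₀ : X) (u : ℝ → U) (y : ℝ≥0 → X) : Prop :=
  Continuous y ∧ ∀ T : ℝ≥0, 0 < T → IsSolOn B T y₀ u y

/-- `ŷ(T; y₀, v) = 0`. -/
def SteersOn (T : ℝ≥0) (y₀ : X) (v : ℝ → U) : Prop :=
  ∃ y : ℝ≥0 → X, IsSolOn B T y₀ v y ∧ y T = 0

/-- `y(t; y₀, u) = 0`. -/
def Steers (t : ℝ≥0) (y₀ : X) (u : ℝ → U) : Prop :=
  ∃ y : ℝ≥0 → X, IsSol B y₀ u y ∧ y t = 0

/-! ### The minimal norm problem `(NP)^{T,y₀}` -/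

/-- `v` is an admissible control to `(NP)^{T,y₀}`. -/
def NPAdm (T : ℝ≥0) (y₀ : X) (v : ℝ → U) : Prop :=
  MemLp v ∞ (vol T) ∧ SteersOn B T y₀ v

/-- The minimal norm `N(T, y₀) ∈ [0, ∞]` (it is `∞` if there is no admissible control). -/
def minNorm (T : ℝ≥0) (y₀ : X) : ℝ≥0∞ :=
  ⨅ (v : ℝ → U) (_ : NPAdm B T y₀ v), eLpNorm v ∞ (vol T)

/-- `v` is a minimal norm control to `(NP)^{T,y₀}`. -/
def IsMinNormControl (T : ℝ≥0) (y₀ : X) (v : ℝ → U) : Prop :=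
  NPAdm B T y₀ v ∧ eLpNorm v ∞ (vol T) = minNorm B T y₀

/-- The bang-bang property of `(NP)^{T,y₀}`; it fails if there is no admissible control. -/
def NPBangBang (T : ℝ≥0) (y₀ : X) : Prop :=
  (∃ v, NPAdm B T y₀ v) ∧
    ∀ v, IsMinNormControl B T y₀ v → ∀ᵐ t ∂(vol T), ‖v t‖ₑ = minNorm B T y₀

/-- The null control is the unique minimal norm control to `(NP)^{T,y₀}` (controls are identified
if they agree almost everywhere on `(0, T)`). -/
def NullIsUniqueMinNormControl (T : ℝ≥0) (y₀ : X) : Prop :=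
  IsMinNormControl B T y₀ (fun _ => 0) ∧
    ∀ v, IsMinNormControl B T y₀ v → ∀ᵐ t ∂(vol T), v t = 0

/-- The function `N(·, y₀)` on `[0, ∞]`, extended by its limits at `0⁺` and at `∞`. (These limits
exist, since `N(·, y₀)` is decreasing on `(0, ∞)`.) -/
def minNormExt (τ : ℝ≥0∞) (y₀ : X) : ℝ≥0∞ :=
  if τ = ∞ then limUnder atTop (fun T : ℝ≥0 => minNorm B T y₀)
  else if τ = 0 then limUnder (𝓝[>] 0) (fun T : ℝ≥0 => minNorm B T y₀)
  else minNorm B τ.toNNReal y₀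

/-! ### The minimal time problem `(TP)^{M,y₀}` -/

/-- The set `𝒰^M` of control constraints. -/
def ctrlSet (U : Type*) [NormedAddCommGroup U] (M : ℝ≥0) : Set (ℝ → U) :=
  {u | AEStronglyMeasurable u volPos ∧ ∀ᵐ t ∂volPos, ‖u t‖ ≤ M}

/-- `u` is an admissible control to `(TP)^{M,y₀}`. -/
def TPAdm (M : ℝ≥0) (y₀ : X) (u : ℝ → U) : Prop :=
  u ∈ ctrlSet U M ∧ ∃ t : ℝ≥0, 0 < t ∧ Steers B t y₀ u

/-- The minimal time `T(M, y₀) ∈ [0, ∞]` (it is `∞` if there is no admissible control). -/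
def minTime (M : ℝ≥0) (y₀ : X) : ℝ≥0∞ :=
  ⨅ (t : ℝ≥0) (_ : 0 < t ∧ ∃ u ∈ ctrlSet U M, Steers B t y₀ u), (t : ℝ≥0∞)

/-- `u` is a minimal time control to `(TP)^{M,y₀}`: `u ∈ 𝒰^M`, `y(T(M, y₀); y₀, u) = 0` (with
`T(M, y₀) < ∞`), and `u = 0` after the time `T(M, y₀)`. -/
def IsMinTimeControl (M : ℝ≥0) (y₀ : X) (u : ℝ → U) : Prop :=
  u ∈ ctrlSet U M ∧ ∃ t : ℝ≥0, (t : ℝ≥0∞) = minTime B M y₀ ∧ Steers B t y₀ u ∧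
    ∀ᵐ s ∂(volume.restrict (Ioi (t : ℝ))), u s = 0

/-- The bang-bang property of `(TP)^{M,y₀}`; it fails if there is no admissible control. -/
def TPBangBang (M : ℝ≥0) (y₀ : X) : Prop :=
  (∃ u, TPAdm B M y₀ u) ∧
    ∀ u, IsMinTimeControl B M y₀ u → ∀ᵐ t ∂(vol (minTime B M y₀).toNNReal), ‖u t‖ = M

/-! ### The functions `T⁰`, `T¹` and the decompositions -/

/-- `T⁰(y₀)`, the infimum of the times at which `y₀` can be steered to `0` by `L^∞` controls. -/
def T0 (y₀ : X) : ℝ≥0∞ :=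
  ⨅ (t : ℝ≥0) (_ : ∃ u : ℝ → U, MemLp u ∞ volPos ∧ Steers B t y₀ u), (t : ℝ≥0∞)

variable (S) in
/-- `T¹(y₀)`, the infimum of the times `t` with `S(t) y₀ = 0`. -/
def T1 (y₀ : X) : ℝ≥0∞ :=
  ⨅ (t : ℝ≥0) (_ : S.op t y₀ = 0), (t : ℝ≥0∞)

/-- `N(T⁰(y₀), y₀)`. -/
def NT0 (y₀ : X) : ℝ≥0∞ := minNormExt B (T0 B y₀) y₀

/-- `N(T¹(y₀), y₀)`. -/
def NT1 (y₀ : X) : ℝ≥0∞ := minNormExt B (S.T1 y₀) y₀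

/-- The set `(0, ∞) × (X ∖ {0})`. It is both the domain `𝒲` of the pairs `(T, y₀)` and the domain
`𝒱` of the pairs `(M, y₀)`. -/
def dom (X : Type*) [NormedAddCommGroup X] : Set (ℝ≥0 × X) := {p | 0 < p.1 ∧ p.2 ≠ 0}

/-- `𝒲₂`. -/
def W2 : Set (ℝ≥0 × X) := {p | p ∈ dom X ∧ 0 < NT0 B p.2 ∧ NT0 B p.2 < ∞}

/-- `𝒲₂,₂`. -/
def W22 : Set (ℝ≥0 × X) := {p | p ∈ W2 B ∧ (p.1 : ℝ≥0∞) = T0 B p.2}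

/-- `𝒲₃`. -/
def W3 : Set (ℝ≥0 × X) := {p | p ∈ dom X ∧ NT0 B p.2 = ∞}

/-- `𝒲₃,₂`. -/
def W32 : Set (ℝ≥0 × X) :=
  {p | p ∈ W3 B ∧ T0 B p.2 < ∞ ∧ T0 B p.2 < p.1 ∧ (p.1 : ℝ≥0∞) < S.T1 p.2}

/-- `𝒲₃,₃`. -/
def W33 : Set (ℝ≥0 × X) :=
  {p | p ∈ W3 B ∧ T0 B p.2 < ∞ ∧ T0 B p.2 < p.1 ∧ S.T1 p.2 ≤ p.1}

/-- `𝒱₂`. -/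
def V2 : Set (ℝ≥0 × X) := {p | p ∈ dom X ∧ 0 < NT0 B p.2 ∧ NT0 B p.2 < ∞}

/-- `𝒱₂,₃`. -/
def V23 : Set (ℝ≥0 × X) :=
  {p | p ∈ V2 B ∧ NT1 B p.2 < p.1 ∧ (p.1 : ℝ≥0∞) = NT0 B p.2}

/-- `𝒱₃`. -/
def V3 : Set (ℝ≥0 × X) := {p | p ∈ dom X ∧ NT0 B p.2 = ∞}

/-- `𝒱₃,₁`. -/
def V31 : Set (ℝ≥0 × X) := {p | p ∈ V3 B ∧ T0 B p.2 < ∞ ∧ (p.1 : ℝ≥0∞) ≤ NT1 B p.2}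

/-- `𝒱₃,₂`. -/
def V32 : Set (ℝ≥0 × X) := {p | p ∈ V3 B ∧ T0 B p.2 < ∞ ∧ NT1 B p.2 < p.1}

/-- The critical curve `γ₁`: the points `(T⁰(y₀), y₀)` of `𝒲` with `0 < N(T⁰(y₀), y₀) < ∞`. -/
def gamma1 : Set (ℝ≥0 × X) :=
  {p | p ∈ dom X ∧ (p.1 : ℝ≥0∞) = T0 B p.2 ∧ 0 < NT0 B p.2 ∧ NT0 B p.2 < ∞}

/-- The critical curve `γ₂`: the points `(N(T⁰(y₀), y₀), y₀)` of `𝒱` with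
`0 < N(T⁰(y₀), y₀) < ∞` and `N(T⁰(y₀), y₀) ≠ N(T¹(y₀), y₀)`. -/
def gamma2 : Set (ℝ≥0 × X) :=
  {p | p ∈ dom X ∧ (p.1 : ℝ≥0∞) = NT0 B p.2 ∧ 0 < NT0 B p.2 ∧ NT0 B p.2 < ∞ ∧
    NT0 B p.2 ≠ NT1 B p.2}

/-! ### The assumptions -/

/-- `(A*, B*)` is `L¹`-observable over each interval. -/
def H3 : Prop :=
  ∀ T : ℝ≥0, 0 < T → ∃ C : ℝ, 0 < C ∧
    ∀ z : S.DAdj, ‖S.adjOp T (S.incl z)‖ ≤ C * ∫ t, ‖obs B T z t‖ ∂(vol T)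

/-- `f` is the value at `z ∈ X` of the continuous extension of the operator
`B* S*(T - ·) : D(A*) → L²(0,T;U)` to `X`, i.e. `f = lim B* S*(T - ·) z_n` in `L²(0,T;U)` for a
sequence `z_n ∈ D(A*)` that converges to `z` in `X`. -/
def IsExtObs (T : ℝ≥0) (z : X) (f : ℝ → U) : Prop :=
  MemLp f 2 (vol T) ∧ ∃ zn : ℕ → S.DAdj,
    Tendsto (fun n => S.incl (zn n)) atTop (𝓝 z) ∧
    Tendsto (fun n => eLpNorm (fun t => obs B T (zn n) t - f t) 2 (vol T)) atTop (𝓝 0)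

/-- Unique continuation from sets of positive measure for the extension of `B* S*(T - ·)`. -/
def H4 : Prop :=
  ∀ (z : X) (T : ℝ≥0) (f : ℝ → U), 0 < T → IsExtObs B T z f →
    ∀ E : Set ℝ, MeasurableSet E → E ⊆ Ioo 0 (T : ℝ) → 0 < volume E →
      (∀ᵐ t ∂(volume.restrict E), f t = 0) → ∀ᵐ t ∂(vol T), f t = 0

end C0Semigroup

end

/-! Everything reduces to one predicate, `Steerable B T x K`: the state `x` can be driven to `0` in
time `T` by a control bounded by `K`. Admissibility extends `z ↦ B* S*(T - ·) z` continuously to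
`X`; its adjoint `ctrlMap` is the input map, and the solution is `S(t) y₀ + ctrlMap B t v`.

Two facts drive the proof of (i). By Hahn–Banach, (H3) yields null controls with bound `C ‖x‖` in
every positive time (`H3.exists_steerable`), so `T⁰ = 0`. On the other hand `‖ctrlMap B t v‖ =
O(√t)` for bounded `v`, while `S(t) x → x ≠ 0`; hence `N(t, x) → ∞` as `t → 0` and `N₀ = ∞`. The
decompositions follow.

Under (H3), waiting longer makes null control strictly cheaper (`H3.exists_lt_steerable_add`), so a
bound `M ≤ N₁` never suffices. Conversely, slack in the bound can be traded for a shorter time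
(`H3.exists_steerable_sub`).

For the bang-bang property, (H4) makes the states reached by bounded controls supported in a set of
positive measure dense among all reached states. If a null control stays below its bound on such a
set, mixing in a little of a null control that is large only there lowers the bound everywhere
(`H4.exists_lt_steerable`). This contradicts minimality of the norm directly, and minimality of the
time after the trade just mentioned. Finally, `S(T) y = 0` if and only if `T¹(y) ≤ T`, which decides
when the null control is optimal. -/

noncomputable section

namespace C0Semigroup

/-! ### Local bounds, strong continuity and time averages of a semigroup. -/

section Banach

variable {X : Type*} [NormedAddCommGroup X] [NormedSpace ℝ X] (S : C0Semigroup X)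

theorem op_add_apply (s t : ℝ≥0) (x : X) : S.op (s + t) x = S.op s (S.op t x) := by
  rw [S.op_add]; rfl

theorem op_zero_apply (x : X) : S.op 0 x = x := by
  rw [S.op_zero]; rfl

theorem tendsto_op_nhds_zero (x : X) : Tendsto (fun t => S.op t x) (𝓝 0) (𝓝 x) := by
  have h : (𝓝 (0 : ℝ≥0)) = pure 0 ⊔ 𝓝[>] 0 := by
    rw [← nhdsWithin_singleton, ← nhdsWithin_union]
    have : ({0} ∪ Ioi 0 : Set ℝ≥0) = univ := by
      ext t
      simp
    rw [this, nhdsWithin_univ]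
  rw [h]
  refine tendsto_sup.2 ⟨?_, S.tendsto_op x⟩
  rw [tendsto_pure_left]
  intro s hs
  simp [op_zero_apply, mem_of_mem_nhds hs]

theorem HasGen.hasDerivWithinAt {x y : X} (hxy : S.HasGen x y) {t : ℝ} (ht : 0 ≤ t) :
    HasDerivWithinAt (fun s : ℝ => S.op s.toNNReal x) (S.op t.toNNReal y) (Ioi t) t := by
  rw [hasDerivWithinAt_iff_tendsto_slope' (by simp)]
  have h1 := HasGen.op S hxy t.toNNReal
  have h2 : Tendsto (fun s : ℝ => (s - t).toNNReal) (𝓝[>] t) (𝓝[>] 0) := by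
    refine tendsto_nhdsWithin_iff.2 ⟨?_, ?_⟩
    · have : Continuous fun s : ℝ => (s - t).toNNReal := by fun_prop
      simpa using (this.tendsto t).mono_left nhdsWithin_le_nhds
    · filter_upwards [self_mem_nhdsWithin] with s hs
      simpa using hs
  refine (h1.comp h2).congr' ?_
  filter_upwards [self_mem_nhdsWithin] with s hs
  have hs' : 0 ≤ s - t := sub_nonneg.2 (le_of_lt hs)
  have : s.toNNReal = (s - t).toNNReal + t.toNNReal := by
    rw [← Real.toNNReal_add hs' ht]; simp
  rw [slope_def_module, Function.comp_apply, Real.coe_toNNReal _ hs', this, op_add_apply]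

/-- A family of operators indexed by times is strongly continuous at `x` if it satisfies the
semigroup law, is locally bounded, and is strongly continuous at zero at `x`. -/
theorem continuous_of_semigroup {P : ℝ≥0 → X →L[ℝ] X}
    (hadd : ∀ s t x, P (s + t) x = P s (P t x))
    (hb : ∀ T : ℝ≥0, ∃ K : ℝ, 0 ≤ K ∧ ∀ t ≤ T, ‖P t‖ ≤ K) (x : X)
    (h0 : Tendsto (fun t => P t x) (𝓝 0) (𝓝 x)) : Continuous fun t => P t x := by
  rw [continuous_iff_continuousAt]
  intro t
  obtain ⟨K, hK, h⟩ := hb (t + 1)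
  have key : ∀ᶠ s in 𝓝 t, dist (P s x) (P t x) ≤ K * dist (P (max s t - min s t) x) x := by
    filter_upwards [eventually_lt_nhds (show t < t + 1 by simp)] with s hs
    have e : ∀ a r : ℝ≥0, a ≤ t + 1 → dist (P (a + r) x) (P a x) ≤ K * dist (P r x) x := by
      intro a r ha
      rw [hadd, dist_eq_norm, dist_eq_norm, ← map_sub]
      exact (P a).le_of_opNorm_le (h a ha) _
    rcases le_total s t with hst | hst
    · rw [max_eq_right hst, min_eq_left hst, dist_comm]
      have := e s (t - s) hs.le
      rwa [add_tsub_cancel_of_le hst] at this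
    · rw [max_eq_left hst, min_eq_right hst]
      have := e t (s - t) (by simp)
      rwa [add_tsub_cancel_of_le hst] at this
  have hc : Tendsto (fun s : ℝ≥0 => max s t - min s t) (𝓝 t) (𝓝 0) := by
    have : Continuous fun s : ℝ≥0 => max s t - min s t := by fun_prop
    simpa using this.tendsto t
  rw [ContinuousAt, tendsto_iff_dist_tendsto_zero]
  refine squeeze_zero' (Eventually.of_forall fun _ => dist_nonneg) key ?_
  have := (tendsto_iff_dist_tendsto_zero.1 (h0.comp hc)).const_mul K
  simpa using this

theorem norm_integral_op_le {K : ℝ} {a b : ℝ≥0} (hab : a ≤ b) (hK : ∀ t ≤ b, ‖S.op t‖ ≤ K) (x : X) :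
    ‖∫ s in (a : ℝ)..b, S.op s.toNNReal x‖ ≤ K * ‖x‖ * (b - a) := by
  refine (intervalIntegral.norm_integral_le_of_norm_le_const (C := K * ‖x‖)
    fun s hs => ?_).trans (le_of_eq ?_)
  · rw [uIoc_of_le (NNReal.coe_le_coe.2 hab)] at hs
    exact (S.op _).le_of_opNorm_le (hK _ (Real.toNNReal_le_iff_le_coe.2 hs.2)) x
  · rw [abs_of_nonneg (sub_nonneg.2 (by exact_mod_cast hab))]

variable [CompleteSpace X]

/-- Otherwise `‖S(t_n)‖ > n` along some `t_n → 0`. But every orbit `S(t_n) x` converges, so the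
uniform boundedness principle is violated. -/
theorem exists_norm_op_le_near_zero :
    ∃ δ : ℝ≥0, 0 < δ ∧ ∃ K : ℝ, ∀ t ≤ δ, ‖S.op t‖ ≤ K := by
  by_contra! h
  have h' : ∀ n : ℕ, ∃ t : ℝ≥0, t ≤ ((n : ℝ≥0) + 1)⁻¹ ∧ (n : ℝ) < ‖S.op t‖ := fun n =>
    h _ (by positivity) n
  choose t ht hn using h'
  have ht0 : Tendsto t atTop (𝓝 0) := by
    refine tendsto_of_tendsto_of_tendsto_of_le_of_le tendsto_const_nhds ?_ (fun _ => zero_le) ht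
    simpa using tendsto_one_div_add_atTop_nhds_zero_nat (𝕜 := ℝ≥0)
  obtain ⟨C, hC⟩ := banach_steinhaus (g := fun n => S.op (t n)) fun x => by
    obtain ⟨C, hC⟩ := (((S.tendsto_op_nhds_zero x).comp ht0).norm).bddAbove_range
    exact ⟨C, fun n => hC ⟨n, rfl⟩⟩
  obtain ⟨n, hn'⟩ := exists_nat_gt C
  exact absurd (hC n) (not_le.2 (hn'.trans (hn n)))

theorem exists_norm_op_le (T : ℝ≥0) : ∃ K : ℝ, 0 ≤ K ∧ ∀ t ≤ T, ‖S.op t‖ ≤ K := by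
  obtain ⟨δ, hδ, K, hK⟩ := S.exists_norm_op_le_near_zero
  have hn : ∀ n : ℕ, ∃ K : ℝ, 0 ≤ K ∧ ∀ t ≤ n * δ, ‖S.op t‖ ≤ K := by
    intro n
    induction n with
    | zero =>
      refine ⟨max K 0, le_max_right _ _, fun t ht => (hK t ?_).trans (le_max_left _ _)⟩
      exact ht.trans (by simp)
    | succ n ih =>
      obtain ⟨K', hK', h⟩ := ih
      refine ⟨max K' (K * K'), le_max_of_le_left hK', fun t ht => ?_⟩
      rcases le_total t (n * δ) with h1 | h1
      · exact (h t h1).trans (le_max_left _ _)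
      · obtain ⟨r, rfl⟩ := exists_add_of_le h1
        have hr : r ≤ δ := by
          have : (n : ℝ≥0) * δ + r ≤ n * δ + δ := by
            refine ht.trans (le_of_eq ?_); push_cast; ring
          exact le_of_add_le_add_left this
        rw [add_comm, S.op_add]
        refine ((S.op r).opNorm_comp_le _).trans (le_max_of_le_right ?_)
        exact mul_le_mul (hK r hr) (h _ le_rfl) (norm_nonneg _) ((norm_nonneg _).trans (hK r hr))
  obtain ⟨n, hn'⟩ := exists_nat_ge (T / δ)
  obtain ⟨K', h0, h⟩ := hn n
  exact ⟨K', h0, fun t ht => h t (ht.trans ((div_le_iff₀ hδ).1 hn'))⟩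

theorem continuous_op (x : X) : Continuous fun t => S.op t x :=
  continuous_of_semigroup S.op_add_apply S.exists_norm_op_le x (S.tendsto_op_nhds_zero x)

/-- The bounded operator `x ↦ ∫₀ʰ S(s) x ds`. -/
def integralOp (h : ℝ≥0) : X →L[ℝ] X :=
  LinearMap.mkContinuousOfExistsBound
    { toFun := fun x => ∫ s in (0 : ℝ)..h, S.op s.toNNReal x
      map_add' := fun x y => by
        simp only [map_add]
        exact intervalIntegral.integral_add
          (((S.continuous_op x).comp continuous_real_toNNReal).intervalIntegrable _ _)
          (((S.continuous_op y).comp continuous_real_toNNReal).intervalIntegrable _ _)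
      map_smul' := fun c x => by
        simp only [map_smul]
        exact intervalIntegral.integral_smul _ _ }
    (by
      obtain ⟨K, hK, hb⟩ := S.exists_norm_op_le h
      refine ⟨K * h, fun x => ?_⟩
      refine (intervalIntegral.norm_integral_le_of_norm_le_const (C := K * ‖x‖)
        fun s hs => ?_).trans (le_of_eq ?_)
      · rw [uIoc_of_le (NNReal.coe_nonneg h)] at hs
        exact (S.op _).le_of_opNorm_le (hb _ (Real.toNNReal_le_iff_le_coe.2 hs.2)) x
      · simp; ring)

theorem integralOp_apply (h : ℝ≥0) (x : X) :
    S.integralOp h x = ∫ s in (0 : ℝ)..h, S.op s.toNNReal x := rfl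

theorem intervalIntegrable_op (x : X) (a b : ℝ) :
    IntervalIntegrable (fun s : ℝ => S.op s.toNNReal x) volume a b :=
  ((S.continuous_op x).comp continuous_real_toNNReal).intervalIntegrable _ _

theorem integralOp_op (h t : ℝ≥0) (x : X) : S.integralOp h (S.op t x) =
    ∫ s in (t : ℝ)..(h + t), S.op s.toNNReal x := by
  have : ∫ s in (t : ℝ)..(h + t), S.op s.toNNReal x
      = ∫ s in (0 : ℝ)..h, S.op (s + t).toNNReal x := by
    rw [intervalIntegral.integral_comp_add_right (fun s : ℝ => S.op s.toNNReal x)]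
    simp
  rw [this, integralOp_apply]
  refine intervalIntegral.integral_congr fun s hs => ?_
  rw [uIcc_of_le (NNReal.coe_nonneg h)] at hs
  rw [Real.toNNReal_add hs.1 (NNReal.coe_nonneg t), Real.toNNReal_coe, op_add_apply]

/-- The overlap of `[t, h + t]` and `[0, h]` cancels. The two remaining intervals have length `t`,
which makes the averages Lipschitz in time, uniformly in `x` of norm one. -/
theorem integralOp_op_sub (h t : ℝ≥0) (x : X) : S.integralOp h (S.op t x - x) =
    (∫ s in (h : ℝ)..(h + t), S.op s.toNNReal x) - ∫ s in (0 : ℝ)..t, S.op s.toNNReal x := by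
  rw [map_sub, integralOp_op, integralOp_apply]
  have i := S.intervalIntegrable_op x
  rw [← intervalIntegral.integral_add_adjacent_intervals (i t h) (i h (h + t)),
    ← intervalIntegral.integral_add_adjacent_intervals (i 0 t) (i t h)]
  abel

theorem HasGen.integralOp {x y : X} (hxy : S.HasGen x y) (h : ℝ≥0) :
    S.integralOp h y = S.op h x - x := by
  have := intervalIntegral.integral_eq_sub_of_hasDeriv_right (a := 0) (b := (h : ℝ))
    (f := fun s : ℝ => S.op s.toNNReal x) (f' := fun s : ℝ => S.op s.toNNReal y)
    ((S.continuous_op x).comp continuous_real_toNNReal).continuousOn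
    (fun t ht => HasGen.hasDerivWithinAt S hxy (by simpa using ht.1.le))
    (S.intervalIntegrable_op y _ _)
  rw [integralOp_apply, this]
  simp [op_zero_apply]

/-- The averages `h⁻¹ ∫₀ʰ S(s) x ds` determine `x`. -/
theorem eq_zero_of_integralOp {x : X} (hx : ∀ h, S.integralOp h x = 0) : x = 0 := by
  have hc : Continuous fun s : ℝ => S.op s.toNNReal x :=
    (S.continuous_op x).comp continuous_real_toNNReal
  have hd := intervalIntegral.integral_hasDerivAt_right (S.intervalIntegrable_op x 0 0)
    (hc.stronglyMeasurableAtFilter _ _) hc.continuousAt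
  have hd' := hd.hasDerivWithinAt (s := Ici 0)
  have h0 : HasDerivWithinAt (fun u : ℝ => ∫ s in (0 : ℝ)..u, S.op s.toNNReal x) 0 (Ici 0) 0 := by
    refine (hasDerivWithinAt_const (0 : ℝ) (Ici 0) (0 : X)).congr (fun u hu => ?_) (by simp)
    have := hx ⟨u, hu⟩
    exact this
  have := (uniqueDiffOn_Ici (0 : ℝ) 0 (by simp)).eq_deriv _ hd' h0
  simpa [op_zero_apply] using this

end Banach

/-! ### Density of `D(A*)` and strong continuity of the adjoint semigroup. -/

section Hilbert

variable {X : Type*} [NormedAddCommGroup X] [InnerProductSpace ℝ X] [CompleteSpace X]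
variable (S : C0Semigroup X)

theorem adjOp_add_apply (s t : ℝ≥0) (x : X) : S.adjOp (s + t) x = S.adjOp s (S.adjOp t x) := by
  rw [add_comm, adjOp, S.op_add, ContinuousLinearMap.adjoint_comp]; rfl

theorem norm_adjOp (t : ℝ≥0) : ‖S.adjOp t‖ = ‖S.op t‖ := by
  simp [adjOp]

theorem inner_adjOp (t : ℝ≥0) (x z : X) : inner ℝ x (S.adjOp t z) = inner ℝ (S.op t x) z := by
  simp [adjOp, ContinuousLinearMap.adjoint_inner_right]

/-- For `x ∈ D(A)` the average of `A x` is `S(h) x - x`, which is bounded in `x`; so `A*` sends this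
vector to `S*(h) z - z`. -/
theorem adjoint_integralOp_mem (h : ℝ≥0) (z : X) :
    ContinuousLinearMap.adjoint (S.integralOp h) z ∈ S.generator.adjoint.domain := by
  refine LinearPMap.mem_adjoint_domain_of_exists _ ⟨S.adjOp h z - z, fun x => ?_⟩
  rw [ContinuousLinearMap.adjoint_inner_left, HasGen.integralOp S (S.hasGen_generator x),
    inner_sub_left, inner_sub_right, adjOp, ContinuousLinearMap.adjoint_inner_left]

theorem exists_incl_eq {z : X} (hz : z ∈ S.generator.adjoint.domain) : ∃ p : S.DAdj, S.incl p = z :=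
  ⟨⟨(z, S.generator.adjoint ⟨z, hz⟩), LinearPMap.mem_graph _ ⟨z, hz⟩⟩, rfl⟩

/-- `⋃_h Ran (∫₀ʰ S*(s) ds)` spans a dense subspace of `X`. -/
theorem topologicalClosure_span_adjoint_integralOp :
    (Submodule.span ℝ {x : X | ∃ h z, x = ContinuousLinearMap.adjoint (S.integralOp h) z}
      ).topologicalClosure = ⊤ := by
  rw [Submodule.topologicalClosure_eq_top_iff, Submodule.eq_bot_iff]
  intro x hx
  rw [Submodule.mem_orthogonal] at hx
  -- A vector orthogonal to all these ranges is annihilated by every average, hence is zero.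
  refine S.eq_zero_of_integralOp fun h => ext_inner_left ℝ fun z => ?_
  rw [inner_zero_right, ← ContinuousLinearMap.adjoint_inner_left]
  exact hx _ (Submodule.subset_span ⟨h, z, rfl⟩)

theorem denseRange_incl : DenseRange S.incl := by
  have h : (Submodule.span ℝ {x : X | ∃ h z, x = ContinuousLinearMap.adjoint (S.integralOp h) z})
      ≤ LinearMap.range (S.incl : S.DAdj →ₗ[ℝ] X) := by
    refine Submodule.span_le.2 ?_
    rintro _ ⟨h, z, rfl⟩
    exact S.exists_incl_eq (S.adjoint_integralOp_mem h z)
  have h1 := Submodule.topologicalClosure_mono h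
  rw [topologicalClosure_span_adjoint_integralOp, top_le_iff] at h1
  have := (Submodule.dense_iff_topologicalClosure_eq_top.2 h1)
  exact this

theorem ext_incl {x y : X} (h : ∀ z : S.DAdj, inner ℝ x (S.incl z) = inner ℝ y (S.incl z)) :
    x = y := by
  refine ext_inner_right ℝ fun z => ?_
  refine S.denseRange_incl.induction_on z ?_ h
  exact isClosed_eq (by fun_prop) (by fun_prop)

/-- Paired with `x`, the increment becomes `⟨z, ∫₀ʰ S(s)(S(t) x - x) ds⟩ = O(t) ‖x‖`; taking `x` to
be the increment itself gives norm convergence. -/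
theorem tendsto_adjOp_adjoint_integralOp (h : ℝ≥0) (z : X) :
    Tendsto (fun t => S.adjOp t (ContinuousLinearMap.adjoint (S.integralOp h) z)) (𝓝 0)
      (𝓝 (ContinuousLinearMap.adjoint (S.integralOp h) z)) := by
  obtain ⟨K, hK, hb⟩ := S.exists_norm_op_le (h + 1)
  rw [tendsto_iff_dist_tendsto_zero]
  have hlim : Tendsto (fun t : ℝ≥0 => 2 * K * ‖z‖ * (t : ℝ)) (𝓝 0) (𝓝 0) := by
    have : Continuous fun t : ℝ≥0 => 2 * K * ‖z‖ * (t : ℝ) := by fun_prop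
    simpa using this.tendsto 0
  refine squeeze_zero' (Eventually.of_forall fun _ => dist_nonneg) ?_ hlim
  filter_upwards [eventually_lt_nhds (show (0 : ℝ≥0) < 1 by simp)] with t ht
  rw [dist_eq_norm]
  set w := ContinuousLinearMap.adjoint (S.integralOp h) z with hw
  have hin : ∀ x : X, inner ℝ (S.adjOp t w - w) x ≤ 2 * K * ‖z‖ * t * ‖x‖ := by
    intro x
    have e : inner ℝ (S.adjOp t w - w) x = inner ℝ z (S.integralOp h (S.op t x - x)) := by
      rw [inner_sub_left, adjOp, ContinuousLinearMap.adjoint_inner_left, ← inner_sub_right, hw,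
        ContinuousLinearMap.adjoint_inner_left]
    rw [e]
    refine (real_inner_le_norm _ _).trans ?_
    have h1 : ‖∫ s in (h : ℝ)..(h + t : ℝ≥0), S.op s.toNNReal x‖ ≤ K * ‖x‖ * ((h + t : ℝ≥0) - h) :=
      S.norm_integral_op_le (by simp) (fun s hs => hb s (hs.trans (by gcongr))) x
    have h2 : ‖∫ s in ((0 : ℝ≥0) : ℝ)..t, S.op s.toNNReal x‖ ≤ K * ‖x‖ * (t - (0 : ℝ≥0)) :=
      S.norm_integral_op_le zero_le (fun s hs => hb s
        (hs.trans (ht.le.trans (le_add_of_nonneg_left zero_le)))) x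
    have h3 : ‖S.integralOp h (S.op t x - x)‖ ≤ 2 * K * t * ‖x‖ := by
      rw [integralOp_op_sub]
      refine (norm_sub_le _ _).trans ?_
      push_cast at h1 h2
      linarith
    calc ‖z‖ * ‖S.integralOp h (S.op t x - x)‖ ≤ ‖z‖ * (2 * K * t * ‖x‖) := by gcongr
      _ = _ := by ring
  rcases (norm_nonneg (S.adjOp t w - w)).eq_or_lt with h0 | h0
  · rw [← h0]; positivity
  · have := hin (S.adjOp t w - w)
    rw [real_inner_self_eq_norm_mul_norm] at this
    exact le_of_mul_le_mul_right this h0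

/-- Convergence holds on the dense span of the adjoint averages and passes to the closure by the
uniform bound on `[0, 1]`. -/
theorem tendsto_adjOp_nhds_zero (x : X) : Tendsto (fun t => S.adjOp t x) (𝓝 0) (𝓝 x) := by
  have hspan : ∀ y ∈ Submodule.span ℝ
      {x : X | ∃ h z, x = ContinuousLinearMap.adjoint (S.integralOp h) z},
      Tendsto (fun t => S.adjOp t y) (𝓝 0) (𝓝 y) := by
    intro y hy
    induction hy using Submodule.span_induction with
    | mem y hy =>
      obtain ⟨h, z, rfl⟩ := hy
      exact S.tendsto_adjOp_adjoint_integralOp h z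
    | zero => simp
    | add y y' _ _ h h' => simpa using h.add h'
    | smul c y _ h => simpa using h.const_smul c
  obtain ⟨K, hK, hb⟩ := S.exists_norm_op_le 1
  have hx : x ∈ closure ((Submodule.span ℝ
      {x : X | ∃ h z, x = ContinuousLinearMap.adjoint (S.integralOp h) z} : Submodule ℝ X) :
        Set X) := by
    rw [← Submodule.topologicalClosure_coe, topologicalClosure_span_adjoint_integralOp]
    trivial
  rw [Metric.tendsto_nhds]
  intro ε hε
  obtain ⟨y, hy, hxy⟩ := Metric.mem_closure_iff.1 hx (ε / (2 * (K + 1))) (by positivity)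
  filter_upwards [eventually_lt_nhds (show (0 : ℝ≥0) < 1 by simp),
    Metric.tendsto_nhds.1 (hspan y hy) (ε / 2) (by positivity)] with t ht hty
  have h1 : dist (S.adjOp t x) (S.adjOp t y) ≤ K * dist x y := by
    rw [dist_eq_norm, dist_eq_norm, ← map_sub]
    exact (S.adjOp t).le_of_opNorm_le ((S.norm_adjOp t).trans_le (hb t ht.le)) _
  have h2 : (K + 1) * dist x y < ε / 2 := by
    rw [lt_div_iff₀ (by positivity)] at hxy
    linarith
  calc dist (S.adjOp t x) x
      ≤ dist (S.adjOp t x) (S.adjOp t y) + dist (S.adjOp t y) y + dist y x := dist_triangle4 _ _ _ _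
    _ < ε := by rw [dist_comm y x]; linarith

theorem exists_norm_adjOp_le (T : ℝ≥0) : ∃ K : ℝ, 0 ≤ K ∧ ∀ t ≤ T, ‖S.adjOp t‖ ≤ K := by
  simpa only [norm_adjOp] using S.exists_norm_op_le T

theorem continuous_adjOp (x : X) : Continuous fun t => S.adjOp t x :=
  continuous_of_semigroup S.adjOp_add_apply S.exists_norm_adjOp_le x (S.tendsto_adjOp_nhds_zero x)

end Hilbert

/-! ### Strong continuity of the semigroup on the extrapolation space. -/

theorem continuous_comp_of_bounded {E : Type*} [NormedAddCommGroup E] [NormedSpace ℝ E]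
    {Q : ℝ≥0 → E →L[ℝ] E}
    (hQ : ∀ T : ℝ≥0, ∃ K : ℝ, 0 ≤ K ∧ ∀ t ≤ T, ∀ z, ‖Q t z‖ ≤ K * ‖z‖)
    (hc : ∀ w : StrongDual ℝ E, Continuous fun t => w.comp (Q t)) {r : ℝ → ℝ≥0}
    {b : ℝ → StrongDual ℝ E} (hr : Continuous r) (hb : Continuous b) :
    Continuous fun τ => (b τ).comp (Q (r τ)) := by
  rw [continuous_iff_continuousAt]
  intro τ
  obtain ⟨K, hK, hK'⟩ := hQ (r τ + 1)
  have h1 : Tendsto (fun σ => ‖b σ - b τ‖ * K + ‖(b τ).comp (Q (r σ)) - (b τ).comp (Q (r τ))‖)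
      (𝓝 τ) (𝓝 0) := by
    have := (hc (b τ)).comp hr
    simp only [Function.comp_def] at this
    have h : Continuous fun σ =>
        ‖b σ - b τ‖ * K + ‖(b τ).comp (Q (r σ)) - (b τ).comp (Q (r τ))‖ :=
      (((hb.sub continuous_const).norm).mul continuous_const).add (this.sub continuous_const).norm
    simpa using h.tendsto τ
  rw [ContinuousAt, tendsto_iff_norm_sub_tendsto_zero]
  refine squeeze_zero' (Eventually.of_forall fun _ => norm_nonneg _) ?_ h1
  filter_upwards [(hr.tendsto τ).eventually_lt_const (show r τ < r τ + 1 by simp)] with σ hσ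
  rw [show (b σ).comp (Q (r σ)) - (b τ).comp (Q (r τ)) = (b σ - b τ).comp (Q (r σ)) +
    ((b τ).comp (Q (r σ)) - (b τ).comp (Q (r τ))) by
      rw [ContinuousLinearMap.sub_comp]; abel]
  refine (norm_add_le _ _).trans ?_
  gcongr
  refine (ContinuousLinearMap.opNorm_comp_le _ _).trans ?_
  gcongr
  exact ContinuousLinearMap.opNorm_le_bound _ hK (hK' _ hσ.le)

variable {X : Type*} [NormedAddCommGroup X] [InnerProductSpace ℝ X] [CompleteSpace X]
variable {U : Type*} [NormedAddCommGroup U] [InnerProductSpace ℝ U] [CompleteSpace U]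

section Extrapolation

variable (S : C0Semigroup X)

theorem incl_adjD (t : ℝ≥0) (z : S.DAdj) : S.incl (S.adjD t z) = S.adjOp t (S.incl z) := rfl

theorem adjD_add_apply (s t : ℝ≥0) (z : S.DAdj) : S.adjD (s + t) z = S.adjD s (S.adjD t z) :=
  Subtype.ext (Prod.ext (S.adjOp_add_apply s t _) (S.adjOp_add_apply s t _))

theorem continuous_adjD (z : S.DAdj) : Continuous fun t => S.adjD t z :=
  ((S.continuous_adjOp _).prodMk (S.continuous_adjOp _)).subtype_mk _

theorem exists_norm_adjD_le (T : ℝ≥0) : ∃ K : ℝ, 0 ≤ K ∧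
    ∀ t ≤ T, ∀ z : S.DAdj, ‖S.adjD t z‖ ≤ K * ‖z‖ := by
  obtain ⟨K, hK, hb⟩ := S.exists_norm_adjOp_le T
  refine ⟨K, hK, fun t ht z => max_le ?_ ?_⟩
  · exact ((S.adjOp t).le_of_opNorm_le (hb t ht) _).trans (by gcongr; exact le_max_left _ _)
  · exact ((S.adjOp t).le_of_opNorm_le (hb t ht) _).trans (by gcongr; exact le_max_right _ _)

/-- Extending `w` from the graph of `A*` to `X × X` represents it by a pair `(a, b)`. Then
`S_{-1}(t) w` is represented by `(S(t) a, S(t) b)`, so continuity is inherited from the orbits in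
`X`. -/
theorem continuous_opNeg (w : S.Xneg) : Continuous fun t => S.opNeg t w := by
  obtain ⟨g, hg, -⟩ := exists_extension_norm_eq S.generator.adjoint.graph w
  let a : X := (InnerProductSpace.toDual ℝ X).symm (g.comp (ContinuousLinearMap.inl ℝ X X))
  let b : X := (InnerProductSpace.toDual ℝ X).symm (g.comp (ContinuousLinearMap.inr ℝ X X))
  have e : ∀ t, S.opNeg t w =
      ((innerSL ℝ (S.op t a)).comp (ContinuousLinearMap.fst ℝ X X) +
        (innerSL ℝ (S.op t b)).comp (ContinuousLinearMap.snd ℝ X X)).comp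
          S.generator.adjoint.graph.subtypeL := by
    intro t
    ext z
    have h1 : inner ℝ a (S.adjOp t (z : X × X).1) = g (S.adjOp t (z : X × X).1, 0) := by
      simp [a]
    have h2 : inner ℝ b (S.adjOp t (z : X × X).2) = g (0, S.adjOp t (z : X × X).2) := by
      simp [b]
    have h3 : S.opNeg t w z = g (S.adjD t z : X × X) := (hg (S.adjD t z)).symm
    have h4 : (S.adjD t z : X × X) =
      (S.adjOp t (z : X × X).1, 0) + (0, S.adjOp t (z : X × X).2) := by
      exact (Prod.fst_add_snd (S.adjD t z : X × X)).symm
    rw [h3, h4, map_add, ← h1, ← h2, inner_adjOp, inner_adjOp]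
    simp
  simp_rw [e]
  have := S.continuous_op a
  have := S.continuous_op b
  fun_prop

theorem continuous_opNeg_comp {r : ℝ → ℝ≥0} {b : ℝ → S.Xneg} (hr : Continuous r)
    (hb : Continuous b) : Continuous fun τ => S.opNeg (r τ) (b τ) :=
  continuous_comp_of_bounded S.exists_norm_adjD_le S.continuous_opNeg hr hb

end Extrapolation

/-! ### The observation `B* S*(T - ·)`, its extension to `X`, and the input map. -/

variable {S : C0Semigroup X} (B : U →L[ℝ] S.Xneg)

theorem continuous_adjB : Continuous (adjB B) :=
  (InnerProductSpace.toDual ℝ U).symm.continuous.comp B.flip.continuous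

theorem adjB_add (z z' : S.DAdj) : adjB B (z + z') = adjB B z + adjB B z' := by
  simp [adjB]

theorem adjB_smul (c : ℝ) (z : S.DAdj) : adjB B (c • z) = c • adjB B z := by
  simp [adjB]

theorem continuous_obs (T : ℝ≥0) (z : S.DAdj) : Continuous (obs B T z) := by
  refine (continuous_adjB B).comp ((S.continuous_adjD z).comp ?_)
  fun_prop

theorem obs_add (T : ℝ≥0) (z z' : S.DAdj) : obs B T (z + z') = obs B T z + obs B T z' := by
  funext t; simp [obs, adjB_add]

theorem obs_smul (T : ℝ≥0) (c : ℝ) (z : S.DAdj) : obs B T (c • z) = c • obs B T z := by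
  funext t; simp [obs, adjB_smul]

theorem obs_add_time_of_le (s r : ℝ≥0) (z : S.DAdj) {τ : ℝ} (hτ : τ ≤ s) :
    obs B (s + r) z τ = obs B s (S.adjD r z) τ := by
  rw [obs, obs, ← adjD_add_apply]
  congr 2
  rw [NNReal.coe_add, add_sub_right_comm, Real.toNNReal_add (sub_nonneg.2 hτ)
    (NNReal.coe_nonneg r), Real.toNNReal_coe]

theorem obs_add_time (s r : ℝ≥0) (z : S.DAdj) (τ : ℝ) :
    obs B (s + r) z (τ + s) = obs B r z τ := by
  rw [obs, obs]
  rw [NNReal.coe_add, add_comm (s : ℝ), add_sub_add_right_eq_sub]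

instance (T : ℝ≥0) : IsFiniteMeasure (vol T) := by
  unfold vol; infer_instance

theorem integral_vol {E : Type*} [NormedAddCommGroup E] [NormedSpace ℝ E] (T : ℝ≥0) (f : ℝ → E) :
    ∫ τ, f τ ∂(vol T) = ∫ τ in (0 : ℝ)..T, f τ := by
  rw [intervalIntegral.integral_of_le (NNReal.coe_nonneg T), integral_Ioc_eq_integral_Ioo, vol]

theorem intervalIntegrable_of_integrable_vol {E : Type*} [NormedAddCommGroup E] {T : ℝ≥0}
    {f : ℝ → E} (hf : Integrable f (vol T)) : IntervalIntegrable f volume 0 T := by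
  rwa [intervalIntegrable_iff_integrableOn_Ioo_of_le (NNReal.coe_nonneg T)]

theorem memLp_vol_of_continuous {E : Type*} [NormedAddCommGroup E] {f : ℝ → E} (hf : Continuous f)
    (p : ℝ≥0∞) (T : ℝ≥0) : MemLp f p (vol T) := by
  obtain ⟨C, hC⟩ := (isCompact_Icc (a := (0 : ℝ)) (b := T)).exists_bound_of_continuousOn
    hf.continuousOn
  refine MemLp.of_bound hf.aestronglyMeasurable.restrict C ?_
  exact (ae_restrict_iff' measurableSet_Ioo).2 (Eventually.of_forall
    fun t ht => hC t (Ioo_subset_Icc_self ht))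

theorem integral_vol_apply {E : Type*} [NormedAddCommGroup E] [NormedSpace ℝ E]
    {f : ℝ → StrongDual ℝ E} (hf : Continuous f) (T : ℝ≥0) (z : E) :
    (∫ τ, f τ ∂(vol T)) z = ∫ τ, f τ z ∂(vol T) :=
  ContinuousLinearMap.integral_apply
    (memLp_one_iff_integrable.1 (memLp_vol_of_continuous hf 1 T)) z

theorem memLp_obs (p : ℝ≥0∞) (T t : ℝ≥0) (z : S.DAdj) : MemLp (obs B T z) p (vol t) :=
  memLp_vol_of_continuous (continuous_obs B T z) p t

theorem integral_inner_toLp {μ : Measure ℝ} {f g : ℝ → U} (hf : MemLp f 2 μ) (hg : MemLp g 2 μ) :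
    inner ℝ (hf.toLp f) (hg.toLp g) = ∫ t, inner ℝ (f t) (g t) ∂μ := by
  rw [L2.inner_def]
  refine integral_congr_ae ?_
  filter_upwards [hf.coeFn_toLp, hg.coeFn_toLp] with t h1 h2
  rw [h1, h2]

theorem integrable_inner_of_memLp {μ : Measure ℝ} {f g : ℝ → U} (hf : MemLp f 2 μ)
    (hg : MemLp g 2 μ) : Integrable (fun t => inner ℝ (f t) (g t)) μ := by
  refine (L2.integrable_inner (𝕜 := ℝ) (hf.toLp f) (hg.toLp g)).congr ?_
  filter_upwards [hf.coeFn_toLp, hg.coeFn_toLp] with t h1 h2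
  rw [h1, h2]

variable {B}

/-- Admissibility is tested with the observation itself as control: the state reached, paired with
`z`, is the squared `L²` norm of the observation. -/
theorem Admissible.exists_norm_obs_le (hadm : Admissible B) (T : ℝ≥0) :
    ∃ C : ℝ, 0 ≤ C ∧ ∀ z : S.DAdj, (eLpNorm (obs B T z) 2 (vol T)).toReal ≤ C * ‖S.incl z‖ := by
  rcases eq_or_ne T 0 with rfl | hT
  · refine ⟨0, le_rfl, fun z => ?_⟩
    simp [vol]
  obtain ⟨C, hC, h⟩ := hadm T (pos_iff_ne_zero.2 hT)
  refine ⟨C, hC.le, fun z => ?_⟩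
  obtain ⟨x, hx, hxn⟩ := h (obs B T z) (fun t => memLp_obs B 2 T t z)
  -- Continuity makes the integrand Bochner integrable in `X_{-1}`, so evaluation at `z` passes
  -- under the integral.
  have hcont : Continuous fun τ : ℝ => S.opNeg ((T : ℝ) - τ).toNNReal (B (obs B T z τ)) :=
    S.continuous_opNeg_comp (by fun_prop) (B.continuous.comp (continuous_obs B T z))
  have h1 := congrArg (fun w : S.Xneg => w z) hx
  rw [integral_vol_apply hcont] at h1
  have hm := memLp_obs B 2 T T z
  have h2 : inner ℝ x (S.incl z) = ‖hm.toLp‖ * ‖hm.toLp‖ := by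
    rw [← real_inner_self_eq_norm_mul_norm, integral_inner_toLp]
    refine (show inner ℝ x (S.incl z) = S.emb x z from rfl).trans (h1.trans ?_)
    refine integral_congr_ae (Eventually.of_forall fun τ => ?_)
    exact (inner_adjB B (S.adjD ((T : ℝ) - τ).toNNReal z) (obs B T z τ)).symm
  have h3 : (eLpNorm (obs B T z) 2 (vol T)).toReal = ‖hm.toLp‖ := (Lp.norm_toLp _ hm).symm
  rw [h3] at hxn ⊢
  rcases (norm_nonneg hm.toLp).eq_or_lt with h0 | h0
  · rw [← h0]; positivity
  · refine le_of_mul_le_mul_right ?_ h0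
    rw [← h2]
    calc inner ℝ x (S.incl z) ≤ ‖x‖ * ‖S.incl z‖ := real_inner_le_norm _ _
      _ ≤ C * ‖hm.toLp‖ * ‖S.incl z‖ := by gcongr
      _ = _ := by ring

variable (B)

/-- `z ↦ B* S*(T - ·) z` as a linear map from `D(A*)` to `L²(0,T;U)`. -/
def obsLp (T : ℝ≥0) : S.DAdj →ₗ[ℝ] Lp U 2 (vol T) where
  toFun z := (memLp_obs B 2 T T z).toLp
  map_add' z z' := by
    rw [← MemLp.toLp_add]
    congr 1
    exact obs_add B T z z'
  map_smul' c z := by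
    rw [RingHom.id_apply, ← MemLp.toLp_const_smul]
    congr 1
    exact obs_smul B T c z

/-- The continuous extension of `z ↦ B* S*(T - ·) z` to `X`. -/
def extObs (T : ℝ≥0) : X →L[ℝ] Lp U 2 (vol T) :=
  (obsLp B T).extendOfNorm (S.incl : S.DAdj →ₗ[ℝ] X)

open Classical in
/-- The input map `v ↦ ∫₀ᵀ S_{-1}(T - τ) B v(τ) dτ`, with values in `X`. -/
def ctrlMap (T : ℝ≥0) (v : ℝ → U) : X :=
  if h : MemLp v 2 (vol T) then ContinuousLinearMap.adjoint (extObs B T) h.toLp else 0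

variable {B}

theorem Admissible.extObs_incl (hadm : Admissible B) (T : ℝ≥0) (z : S.DAdj) :
    extObs B T (S.incl z) = (memLp_obs B 2 T T z).toLp := by
  obtain ⟨C, -, hC⟩ := hadm.exists_norm_obs_le T
  exact LinearMap.extendOfNorm_eq (f := obsLp B T) (e := (S.incl : S.DAdj →ₗ[ℝ] X))
    S.denseRange_incl ⟨C, fun z => (Lp.norm_toLp _ (memLp_obs B 2 T T z)).trans_le (hC z)⟩ z

theorem ctrlMap_eq {T : ℝ≥0} {v : ℝ → U} (hv : MemLp v 2 (vol T)) :
    ctrlMap B T v = ContinuousLinearMap.adjoint (extObs B T) hv.toLp := dif_pos hv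

theorem inner_ctrlMap {T : ℝ≥0} {v : ℝ → U} (hv : MemLp v 2 (vol T)) (z : X) :
    inner ℝ (ctrlMap B T v) z = ∫ s, inner ℝ (v s) (extObs B T z s) ∂(vol T) := by
  rw [ctrlMap_eq hv, ContinuousLinearMap.adjoint_inner_left, L2.inner_def]
  refine integral_congr_ae ?_
  filter_upwards [hv.coeFn_toLp] with t h1
  rw [h1]

theorem Admissible.inner_ctrlMap_incl (hadm : Admissible B) {T : ℝ≥0} {v : ℝ → U}
    (hv : MemLp v 2 (vol T)) (z : S.DAdj) :
    inner ℝ (ctrlMap B T v) (S.incl z) = ∫ s, inner ℝ (v s) (obs B T z s) ∂(vol T) := by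
  rw [ctrlMap_eq hv, ContinuousLinearMap.adjoint_inner_left, hadm.extObs_incl, integral_inner_toLp]

theorem ctrlMap_congr {T : ℝ≥0} {v w : ℝ → U} (h : v =ᵐ[vol T] w) :
    ctrlMap B T v = ctrlMap B T w := by
  by_cases hv : MemLp v 2 (vol T)
  · have hw := (memLp_congr_ae h).1 hv
    rw [ctrlMap_eq hv, ctrlMap_eq hw, (MemLp.toLp_eq_toLp_iff hv hw).2 h]
  · have hw := fun hw => hv ((memLp_congr_ae h).2 hw)
    rw [ctrlMap, ctrlMap, dif_neg hv, dif_neg hw]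

theorem ctrlMap_add {T : ℝ≥0} {v w : ℝ → U} (hv : MemLp v 2 (vol T)) (hw : MemLp w 2 (vol T)) :
    ctrlMap B T (v + w) = ctrlMap B T v + ctrlMap B T w := by
  rw [ctrlMap_eq hv, ctrlMap_eq hw, ctrlMap_eq (hv.add hw), MemLp.toLp_add, map_add]

theorem ctrlMap_smul {T : ℝ≥0} {v : ℝ → U} (c : ℝ) (hv : MemLp v 2 (vol T)) :
    ctrlMap B T (c • v) = c • ctrlMap B T v := by
  rw [ctrlMap_eq hv, ctrlMap_eq (hv.const_smul c), MemLp.toLp_const_smul, map_smul]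

theorem ctrlMap_zero (T : ℝ≥0) : ctrlMap B T 0 = 0 := by
  have := ctrlMap_smul (B := B) (T := T) 0 (MemLp.zero' (p := 2))
  simpa using this

theorem norm_ctrlMap_le {T : ℝ≥0} {v : ℝ → U} (hv : MemLp v 2 (vol T)) :
    ‖ctrlMap B T v‖ ≤ ‖extObs B T‖ * (eLpNorm v 2 (vol T)).toReal := by
  rw [ctrlMap_eq hv, ← Lp.norm_toLp v hv]
  refine (ContinuousLinearMap.le_opNorm _ _).trans ?_
  simp

/-- The control that acts as `v` up to time `s`, and then as `c`. -/
def concat (s : ℝ≥0) (v c : ℝ → U) (τ : ℝ) : U := if τ < s then v τ else c (τ - s)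

theorem measurePreserving_sub_vol (s r : ℝ≥0) : MeasurePreserving (fun τ : ℝ => τ - s)
    (volume.restrict (Ioo (s : ℝ) (s + r))) (vol r) := by
  have := (measurePreserving_sub_right volume (s : ℝ)).restrict_preimage
    (measurableSet_Ioo (a := (0 : ℝ)) (b := r))
  have e : (fun x : ℝ => x - s) ⁻¹' Ioo (0 : ℝ) r = Ioo (s : ℝ) (s + r) := by
    ext x
    simp [add_comm]
  rw [e] at this
  exact this

theorem memLp_concat {s r : ℝ≥0} {v c : ℝ → U} {p : ℝ≥0∞} (hv : MemLp v p (vol s))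
    (hc : MemLp c p (vol r)) : MemLp (concat s v c) p (vol (s + r)) := by
  classical
  have e : concat s v c = (Iio (s : ℝ)).piecewise v (fun τ => c (τ - s)) := by
    funext τ; simp [concat, piecewise]
  rw [e]
  refine MemLp.piecewise measurableSet_Iio ?_ ?_
  · rw [vol, Measure.restrict_restrict measurableSet_Iio]
    exact hv.mono_measure (Measure.restrict_mono (fun τ hτ => mem_Ioo.2 ⟨hτ.2.1, hτ.1⟩) le_rfl)
  · have h := hc.comp_measurePreserving (measurePreserving_sub_vol s r)
    rw [vol, Measure.restrict_restrict measurableSet_Iio.compl]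
    refine h.mono_measure ?_
    rw [restrict_Ioo_eq_restrict_Ico]
    refine Measure.restrict_mono (fun τ hτ => mem_Ico.2 ⟨by simpa using hτ.1, ?_⟩) le_rfl
    simpa using hτ.2.2

/-- Tested against `D(A*)`, the integral splits at `s`: before `s` the observation of `z` is that of
`S*(r) z` over `(0, s)`, and after `s` it is a translate of the observation over `(0, r)`. -/
theorem Admissible.ctrlMap_concat (hadm : Admissible B) {s r : ℝ≥0} {v c : ℝ → U}
    (hv : MemLp v 2 (vol s)) (hc : MemLp c 2 (vol r)) :
    ctrlMap B (s + r) (concat s v c) = S.op r (ctrlMap B s v) + ctrlMap B r c := by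
  refine S.ext_incl fun z => ?_
  rw [inner_add_left, ← inner_adjOp, ← incl_adjD, hadm.inner_ctrlMap_incl hv,
    hadm.inner_ctrlMap_incl hc, hadm.inner_ctrlMap_incl (memLp_concat hv hc), integral_vol,
    integral_vol, integral_vol]
  have hi := intervalIntegrable_of_integrable_vol
    (integrable_inner_of_memLp (memLp_concat hv hc) (memLp_obs B 2 (s + r) (s + r) z))
  have hs : (s : ℝ) ∈ uIcc 0 ((s + r : ℝ≥0) : ℝ) := by
    rw [uIcc_of_le (NNReal.coe_nonneg _)]
    exact ⟨s.2, by simp⟩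
  rw [← intervalIntegral.integral_add_adjacent_intervals (b := (s : ℝ))
    (hi.mono_set (uIcc_subset_uIcc_left hs)) (hi.mono_set (uIcc_subset_uIcc_right hs))]
  congr 1
  · rw [intervalIntegral.integral_of_le (NNReal.coe_nonneg s),
      intervalIntegral.integral_of_le (NNReal.coe_nonneg s), integral_Ioc_eq_integral_Ioo,
      integral_Ioc_eq_integral_Ioo]
    refine setIntegral_congr_fun measurableSet_Ioo fun τ hτ => ?_
    simp only [concat, if_pos hτ.2]
    rw [obs_add_time_of_le B s r z hτ.2.le]
  · have := intervalIntegral.integral_comp_add_right (a := 0) (b := (r : ℝ))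
      (fun τ : ℝ => inner ℝ (concat s v c τ) (obs B (s + r) z τ)) (s : ℝ)
    rw [zero_add, add_comm (r : ℝ)] at this
    rw [NNReal.coe_add, ← this]
    refine intervalIntegral.integral_congr fun τ hτ => ?_
    rw [uIcc_of_le (NNReal.coe_nonneg r)] at hτ
    have : ¬ (τ + s < s) := by simpa using hτ.1
    simp only [concat, if_neg this, add_sub_cancel_right, obs_add_time]

/-! ### Continuity of the input maps and existence of solutions -/

/-- Idling from the zero state costs nothing. All input maps with `t ≤ T` thereby become the single
operator at time `T` applied to delayed controls, which gives continuity in `t` and a uniform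
constant. -/
theorem Admissible.ctrlMap_delay (hadm : Admissible B) {t T : ℝ≥0} (h : t ≤ T) {v : ℝ → U}
    (hv : MemLp v 2 (vol t)) (hv0 : ∀ τ < 0, v τ = 0) :
    ctrlMap B T (fun τ => v (τ - (T - t))) = ctrlMap B t v := by
  obtain ⟨s, rfl⟩ := exists_add_of_le h
  have e : (fun τ : ℝ => v (τ - ((t + s : ℝ≥0) - t))) = concat s 0 v := by
    funext τ
    rw [concat]
    push_cast
    rw [add_sub_cancel_left]
    split_ifs with h
    · exact hv0 _ (sub_neg.2 h)
    · rfl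
  rw [e, add_comm t s, hadm.ctrlMap_concat (v := 0) MemLp.zero' hv, ctrlMap_zero, map_zero, zero_add]

theorem ctrlMap_zero_time (v : ℝ → U) : ctrlMap B 0 v = 0 := by
  rw [ctrlMap_congr (w := 0), ctrlMap_zero]
  have : (vol 0) = 0 := by simp [vol]
  rw [this, EventuallyEq, ae_zero]
  exact eventually_bot

/-- After the reduction to time `T`, only the delay depends on `t`, and translation is continuous in
`L²(ℝ; U)`. -/
theorem Admissible.continuousOn_ctrlMap (hadm : Admissible B) {T : ℝ≥0} {v : ℝ → U}
    (hv : MemLp v 2 (vol T)) : ContinuousOn (fun t => ctrlMap B t v) (Icc 0 T) := by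
  set w := (Ioo (0 : ℝ) T).indicator v with hw
  have hwm : MemLp w 2 volume := (memLp_indicator_iff_restrict measurableSet_Ioo).2 hv
  let R : Lp U 2 (volume : Measure ℝ) →L[ℝ] Lp U 2 (vol T) :=
    LpToLpRestrictCLM ℝ U ℝ volume 2 (Ioo (0 : ℝ) T)
  have hc : Continuous fun t : ℝ≥0 => ContinuousLinearMap.adjoint (extObs B T)
      (R (DomAddAct.mk (-((T : ℝ) - t)) +ᵥ hwm.toLp)) := by
    refine (ContinuousLinearMap.continuous (ContinuousLinearMap.adjoint (extObs B T))).comp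
      (R.continuous.comp ?_)
    have : Fact ((2 : ℝ≥0∞) ≠ ∞) := ⟨by simp⟩
    have hs : Continuous fun t : ℝ≥0 => -((T : ℝ) - t) := by fun_prop
    exact (DomAddAct.continuous_mk.comp hs).vadd continuous_const
  refine hc.continuousOn.congr fun t ht => ?_
  have hvw : v =ᵐ[vol t] w := by
    refine (ae_restrict_iff' measurableSet_Ioo).2 (Eventually.of_forall fun τ hτ => ?_)
    rw [hw, indicator_of_mem]
    exact ⟨hτ.1, hτ.2.trans_le (NNReal.coe_le_coe.2 ht.2)⟩
  have hwt : MemLp (fun τ : ℝ => w (τ - (T - t))) 2 volume :=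
    hwm.comp_measurePreserving (measurePreserving_sub_right volume _)
  have hwT : MemLp (fun τ : ℝ => w (τ - (T - t))) 2 (vol T) := hwt.restrict _
  simp only
  rw [ctrlMap_congr hvw, ← hadm.ctrlMap_delay ht.2 (hwm.restrict _)
    (fun τ hτ => indicator_of_notMem (fun h => absurd h.1 hτ.not_gt) v), ctrlMap_eq hwT]
  congr 1
  refine Lp.ext ?_
  refine hwT.coeFn_toLp.trans (EventuallyEq.symm ?_)
  refine (LpToLpRestrictCLM_coeFn ℝ (Ioo (0 : ℝ) T) _).trans ?_
  refine ae_restrict_of_ae ?_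
  rw [DomAddAct.mk_vadd_toLp]
  refine (MemLp.coeFn_toLp _).trans (Eventually.of_forall fun τ => ?_)
  simp only [vadd_eq_add]
  congr 1
  ring

theorem Admissible.isSolOn (hadm : Admissible B) {T : ℝ≥0} (y₀ : X) {v : ℝ → U}
    (hv : MemLp v 2 (vol T)) : IsSolOn B T y₀ v fun t => S.op t y₀ + ctrlMap B t v := by
  refine ⟨(S.continuous_op y₀).continuousOn.add (hadm.continuousOn_ctrlMap hv), fun z t ht => ?_⟩
  have hvt : MemLp v 2 (vol t) := hv.mono_measure
    (Measure.restrict_mono (Ioo_subset_Ioo_right (NNReal.coe_le_coe.2 ht)) le_rfl)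
  rw [inner_add_left, ← inner_adjOp, hadm.inner_ctrlMap_incl hvt, add_sub_cancel_left]

theorem IsSolOn.eq (hadm : Admissible B) {T : ℝ≥0} {y₀ : X} {v : ℝ → U} {y : ℝ≥0 → X}
    (h : IsSolOn B T y₀ v y) (hv : MemLp v 2 (vol T)) : y T = S.op T y₀ + ctrlMap B T v := by
  refine S.ext_incl fun z => ?_
  rw [inner_add_left, ← inner_adjOp, hadm.inner_ctrlMap_incl hv, ← h.2 z T le_rfl]
  abel

theorem Admissible.steersOn_iff (hadm : Admissible B) {T : ℝ≥0} {y₀ : X} {v : ℝ → U}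
    (hv : MemLp v 2 (vol T)) : SteersOn B T y₀ v ↔ S.op T y₀ + ctrlMap B T v = 0 :=
  ⟨fun ⟨_, hy, h0⟩ => (hy.eq hadm hv).symm.trans h0, fun h => ⟨_, hadm.isSolOn y₀ hv, h⟩⟩

theorem Admissible.steers_iff (hadm : Admissible B) {t : ℝ≥0} {y₀ : X} {u : ℝ → U}
    (hu : ∀ T, MemLp u 2 (vol T)) : Steers B t y₀ u ↔ S.op t y₀ + ctrlMap B t u = 0 := by
  constructor
  · rintro ⟨y, hy, h0⟩
    have h := hy.2 (t + 1) (by positivity)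
    have h' : IsSolOn B t y₀ u y := ⟨h.1.mono (Icc_subset_Icc_right (by simp)),
      fun z s hs => h.2 z s (hs.trans (by simp))⟩
    exact (h'.eq hadm (hu t)).symm.trans h0
  · intro h
    refine ⟨fun t => S.op t y₀ + ctrlMap B t u, ⟨?_, fun T _ => hadm.isSolOn y₀ (hu T)⟩, h⟩
    refine continuous_iff_continuousAt.2 fun t => ?_
    refine (hadm.isSolOn y₀ (hu (t + 1))).1.continuousAt ?_
    refine mem_of_superset (Iio_mem_nhds (show t < t + 1 by simp)) fun s hs => ⟨zero_le, le_of_lt hs⟩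

/-! ### Null controls with a bound -/

theorem memLp_of_bounded {v : ℝ → U} {K : ℝ} (hv : StronglyMeasurable v) (hb : ∀ τ, ‖v τ‖ ≤ K)
    (p : ℝ≥0∞) (T : ℝ≥0) : MemLp v p (vol T) :=
  MemLp.of_bound hv.aestronglyMeasurable K (Eventually.of_forall hb)

/-- Setting a measurable representative to zero where it exceeds `K` provides controls bounded
everywhere, the normal form used in `Steerable`. -/
theorem exists_bounded_ae_eq {μ : Measure ℝ} {v : ℝ → U} {K : ℝ} (hK : 0 ≤ K)
    (hv : AEStronglyMeasurable v μ) (hb : ∀ᵐ τ ∂μ, ‖v τ‖ ≤ K) :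
    ∃ w : ℝ → U, StronglyMeasurable w ∧ (∀ τ, ‖w τ‖ ≤ K) ∧ v =ᵐ[μ] w := by
  have hm : MeasurableSet {τ | ‖hv.mk v τ‖ ≤ K} :=
    measurableSet_le hv.stronglyMeasurable_mk.norm.measurable measurable_const
  refine ⟨{τ | ‖hv.mk v τ‖ ≤ K}.indicator (hv.mk v), hv.stronglyMeasurable_mk.indicator hm,
    fun τ => ?_, ?_⟩
  · by_cases h : τ ∈ {τ | ‖hv.mk v τ‖ ≤ K}
    · rw [indicator_of_mem h]; exact h
    · rw [indicator_of_notMem h]; simpa using hK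
  · filter_upwards [hv.ae_eq_mk, hb] with τ h1 h2
    rw [indicator_of_mem, h1]
    rwa [mem_ofPred_eq, ← h1]

variable (B) in
/-- `x` can be steered to `0` in time `T` by a control that is bounded by `K`. -/
def Steerable (T : ℝ≥0) (x : X) (K : ℝ) : Prop :=
  ∃ v : ℝ → U, StronglyMeasurable v ∧ (∀ τ, ‖v τ‖ ≤ K) ∧ S.op T x + ctrlMap B T v = 0

theorem Steerable.nonneg {T : ℝ≥0} {x : X} {K : ℝ} (h : Steerable B T x K) : 0 ≤ K :=
  let ⟨_, _, hb, _⟩ := h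
  (norm_nonneg _).trans (hb 0)

theorem Steerable.mono {T : ℝ≥0} {x : X} {K L : ℝ} (h : Steerable B T x K) (hKL : K ≤ L) :
    Steerable B T x L :=
  let ⟨v, hv, hb, h0⟩ := h
  ⟨v, hv, fun τ => (hb τ).trans hKL, h0⟩

theorem Steerable.add {T : ℝ≥0} {x y : X} {K L : ℝ} (hx : Steerable B T x K)
    (hy : Steerable B T y L) : Steerable B T (x + y) (K + L) := by
  obtain ⟨v, hv, hvb, hv0⟩ := hx
  obtain ⟨w, hw, hwb, hw0⟩ := hy
  refine ⟨v + w, hv.add hw, fun τ => norm_add_le_of_le (hvb τ) (hwb τ), ?_⟩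
  rw [ctrlMap_add (memLp_of_bounded hv hvb 2 T) (memLp_of_bounded hw hwb 2 T), map_add,
    add_add_add_comm, hv0, hw0, add_zero]

theorem op_eq_zero_steerable {T : ℝ≥0} {x : X} (h : S.op T x = 0) : Steerable B T x 0 :=
  ⟨0, stronglyMeasurable_zero, by simp, by rw [h, ctrlMap_zero, add_zero]⟩

theorem stronglyMeasurable_concat (s : ℝ≥0) {v c : ℝ → U} (hv : StronglyMeasurable v)
    (hc : StronglyMeasurable c) : StronglyMeasurable (concat s v c) :=
  StronglyMeasurable.ite (measurableSet_Iio (a := (s : ℝ))) hv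
    (hc.comp_measurable (measurable_id.sub_const _))

theorem Admissible.op_add_ctrlMap_concat (hadm : Admissible B) {s r : ℝ≥0} {v c : ℝ → U}
    (hv : MemLp v 2 (vol s)) (hc : MemLp c 2 (vol r)) (x : X) :
    S.op (s + r) x + ctrlMap B (s + r) (concat s v c) =
      S.op r (S.op s x + ctrlMap B s v) + ctrlMap B r c := by
  rw [hadm.ctrlMap_concat hv hc, add_comm s r, op_add_apply, map_add, add_assoc]

theorem Steerable.concat (hadm : Admissible B) {s r : ℝ≥0} {x : X} {v : ℝ → U} {K L : ℝ}
    (hv : StronglyMeasurable v) (hb : ∀ τ, ‖v τ‖ ≤ K)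
    (h : Steerable B r (S.op s x + ctrlMap B s v) L) : Steerable B (s + r) x (max K L) := by
  obtain ⟨c, hc, hcb, hc0⟩ := h
  refine ⟨C0Semigroup.concat s v c, stronglyMeasurable_concat s hv hc, fun τ => ?_, ?_⟩
  · rw [C0Semigroup.concat]
    split_ifs
    · exact (hb _).trans (le_max_left _ _)
    · exact (hcb _).trans (le_max_right _ _)
  · rw [hadm.op_add_ctrlMap_concat (memLp_of_bounded hv hb 2 s) (memLp_of_bounded hc hcb 2 r), hc0]

theorem Steerable.add_time (hadm : Admissible B) {T : ℝ≥0} {x : X} {K : ℝ} (h : Steerable B T x K)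
    (r : ℝ≥0) : Steerable B (T + r) x K := by
  have hK := h.nonneg
  obtain ⟨v, hv, hb, h0⟩ := h
  refine (Steerable.concat hadm hv hb (L := 0) ?_).mono (max_le le_rfl hK)
  rw [h0]
  exact op_eq_zero_steerable (map_zero _)

theorem Steerable.mono_time (hadm : Admissible B) {T T' : ℝ≥0} {x : X} {K : ℝ}
    (h : Steerable B T x K) (hT : T ≤ T') : Steerable B T' x K := by
  obtain ⟨r, rfl⟩ := exists_add_of_le hT
  exact h.add_time hadm r

/-- The tail of a null control is a null control for the state reached. -/
theorem Admissible.steerable_tail (hadm : Admissible B) {s r : ℝ≥0} {x : X} {v : ℝ → U} {K : ℝ}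
    (hv : StronglyMeasurable v) (hb : ∀ τ, ‖v τ‖ ≤ K)
    (h : S.op (s + r) x + ctrlMap B (s + r) v = 0) :
    Steerable B r (S.op s x + ctrlMap B s v) K := by
  have hm : StronglyMeasurable fun τ => v (τ + s) :=
    hv.comp_measurable (measurable_id.add_const _)
  refine ⟨fun τ => v (τ + s), hm, fun τ => hb _, ?_⟩
  rw [← hadm.op_add_ctrlMap_concat (memLp_of_bounded hv hb 2 s)
    (memLp_of_bounded hm (fun τ => hb _) 2 r)]
  have : C0Semigroup.concat s v (fun τ => v (τ + s)) = v := by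
    funext τ; simp [C0Semigroup.concat]
  rw [this, h]

/-- The constant does not depend on `t ≤ T`, so the bound tends to zero with `t`, and also with `K`.
-/
theorem Admissible.norm_ctrlMap_le_sqrt (hadm : Admissible B) {t T : ℝ≥0} (ht : t ≤ T) {v : ℝ → U}
    {K : ℝ} (hv : StronglyMeasurable v) (hb : ∀ τ, ‖v τ‖ ≤ K) :
    ‖ctrlMap B t v‖ ≤ ‖extObs B T‖ * (√t * K) := by
  have hK : 0 ≤ K := (norm_nonneg _).trans (hb 0)
  set w := (Ioo (0 : ℝ) t).indicator v with hw
  have hvt := memLp_of_bounded hv hb 2 t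
  have hwm : MemLp w 2 volume := (memLp_indicator_iff_restrict measurableSet_Ioo).2 hvt
  have hvw : v =ᵐ[vol t] w := by
    refine (ae_restrict_iff' measurableSet_Ioo).2 (Eventually.of_forall fun τ hτ => ?_)
    rw [hw, indicator_of_mem hτ]
  have hwt : MemLp (fun τ : ℝ => w (τ - (T - t))) 2 volume :=
    hwm.comp_measurePreserving (measurePreserving_sub_right volume _)
  rw [ctrlMap_congr hvw, ← hadm.ctrlMap_delay ht (hwm.restrict _)
    (fun τ hτ => indicator_of_notMem (fun h => absurd h.1 hτ.not_gt) v)]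
  refine (norm_ctrlMap_le (hwt.restrict _)).trans ?_
  gcongr
  refine ENNReal.toReal_le_of_le_ofReal (by positivity) ?_
  calc eLpNorm (fun τ : ℝ => w (τ - (T - t))) 2 (vol T)
      ≤ eLpNorm (w ∘ fun τ : ℝ => τ - (T - t)) 2 volume :=
        eLpNorm_mono_measure _ Measure.restrict_le_self
    _ = eLpNorm w 2 volume := eLpNorm_comp_measurePreserving hwm.1
        (measurePreserving_sub_right volume _)
    _ = eLpNorm v 2 (vol t) := eLpNorm_indicator_eq_eLpNorm_restrict measurableSet_Ioo
    _ ≤ vol t univ ^ (2 : ℝ≥0∞).toReal⁻¹ * ENNReal.ofReal K :=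
        eLpNorm_le_of_ae_bound (Eventually.of_forall hb)
    _ = ENNReal.ofReal (√t * K) := by
        rw [ENNReal.ofReal_mul (by positivity), Real.sqrt_eq_rpow,
          ← ENNReal.ofReal_rpow_of_nonneg (NNReal.coe_nonneg t) (by positivity)]
        simp [vol]

theorem Admissible.norm_op_le_of_steerable (hadm : Admissible B) {t T : ℝ≥0} (ht : t ≤ T) {x : X}
    {K : ℝ} (h : Steerable B t x K) : ‖S.op t x‖ ≤ ‖extObs B T‖ * (√t * K) := by
  obtain ⟨v, hv, hb, h0⟩ := h
  rw [eq_neg_of_add_eq_zero_left h0, norm_neg]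
  exact hadm.norm_ctrlMap_le_sqrt ht hv hb

theorem Admissible.op_eq_zero_of_steerable (hadm : Admissible B) {T : ℝ≥0} {x : X}
    (h : ∀ K > 0, Steerable B T x K) : S.op T x = 0 := by
  have hc : Continuous fun K : ℝ => ‖extObs B T‖ * (√T * K) := by fun_prop
  have := ge_of_tendsto ((hc.tendsto 0).mono_left (nhdsWithin_le_nhds (s := Ioi 0)))
    (by filter_upwards [self_mem_nhdsWithin] with K hK
        exact hadm.norm_op_le_of_steerable le_rfl (h K hK))
  simpa using this

theorem Admissible.eventually_not_steerable (hadm : Admissible B) {x : X} (hx : x ≠ 0) (K : ℝ) :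
    ∀ᶠ t in 𝓝 (0 : ℝ≥0), ¬ Steerable B t x K := by
  have hc : Continuous fun t : ℝ≥0 => ‖S.op t x‖ - ‖extObs B 1‖ * (√t * K) := by
    have := S.continuous_op x
    fun_prop
  have h0 : 0 < ‖S.op 0 x‖ - ‖extObs B 1‖ * (√(0 : ℝ≥0) * K) := by
    simpa [op_zero_apply] using hx
  filter_upwards [(hc.tendsto 0).eventually_const_lt h0,
    eventually_lt_nhds (show (0 : ℝ≥0) < 1 by simp)] with t ht ht1 h
  exact absurd (hadm.norm_op_le_of_steerable ht1.le h) (not_le.2 (sub_pos.1 ht))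

/-! ### Reformulation of the optimal control problems -/

theorem Admissible.npAdm_of_bounded (hadm : Admissible B) {T : ℝ≥0} {x : X} {v : ℝ → U} {K : ℝ}
    (hv : StronglyMeasurable v) (hb : ∀ τ, ‖v τ‖ ≤ K) (h : S.op T x + ctrlMap B T v = 0) :
    NPAdm B T x v :=
  ⟨memLp_of_bounded hv hb _ T, (hadm.steersOn_iff (memLp_of_bounded hv hb 2 T)).2 h⟩

theorem Admissible.minNorm_le (hadm : Admissible B) {T : ℝ≥0} {x : X} {K : ℝ}
    (h : Steerable B T x K) : minNorm B T x ≤ ENNReal.ofReal K := by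
  obtain ⟨v, hv, hb, h0⟩ := h
  refine (iInf₂_le v (hadm.npAdm_of_bounded hv hb h0)).trans ?_
  refine (eLpNorm_le_of_ae_bound (Eventually.of_forall hb)).trans (le_of_eq ?_)
  simp

theorem Admissible.exists_bounded_of_npAdm (hadm : Admissible B) {T : ℝ≥0} {x : X} {v : ℝ → U}
    {K : ℝ} (hK : 0 ≤ K) (h : NPAdm B T x v) (hv : eLpNorm v ∞ (vol T) ≤ ENNReal.ofReal K) :
    ∃ w : ℝ → U, StronglyMeasurable w ∧ (∀ τ, ‖w τ‖ ≤ K) ∧ S.op T x + ctrlMap B T w = 0 ∧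
      v =ᵐ[vol T] w := by
  have hb : ∀ᵐ τ ∂(vol T), ‖v τ‖ ≤ K := by
    filter_upwards [ae_le_eLpNormEssSup (f := v) (μ := vol T)] with τ hτ
    rw [← eLpNorm_exponent_top] at hτ
    have := hτ.trans hv
    rwa [← ofReal_norm, ENNReal.ofReal_le_ofReal_iff hK] at this
  obtain ⟨w, hw, hwb, hvw⟩ := exists_bounded_ae_eq hK h.1.1 hb
  refine ⟨w, hw, hwb, ?_, hvw⟩
  rw [← ctrlMap_congr hvw]
  exact (hadm.steersOn_iff ((memLp_congr_ae hvw).2 (memLp_of_bounded hw hwb 2 T))).1 h.2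

theorem Admissible.steerable_of_minNorm_lt (hadm : Admissible B) {T : ℝ≥0} {x : X} {K : ℝ}
    (h : minNorm B T x < ENNReal.ofReal K) : Steerable B T x K := by
  have hK : 0 < K := ENNReal.ofReal_pos.1 (zero_le.trans_lt h)
  rw [minNorm] at h
  simp only [iInf_lt_iff] at h
  obtain ⟨v, hv, hlt⟩ := h
  obtain ⟨w, hw, hwb, hw0, -⟩ := hadm.exists_bounded_of_npAdm hK.le hv hlt.le
  exact ⟨w, hw, hwb, hw0⟩

theorem Admissible.minNorm_antitone (hadm : Admissible B) (x : X) :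
    Antitone fun T => minNorm B T x := by
  intro T T' hT
  refine le_of_forall_gt fun c hc => ?_
  obtain ⟨b, hb, hbc⟩ := exists_between hc
  have e : ENNReal.ofReal b.toReal = b := ENNReal.ofReal_toReal (ne_top_of_lt hbc)
  rw [← e] at hb
  exact ((hadm.minNorm_le ((hadm.steerable_of_minNorm_lt hb).mono_time hadm hT)).trans_eq
    e).trans_lt hbc

theorem exists_bounded_of_mem_ctrlSet {M : ℝ≥0} {u : ℝ → U} (hu : u ∈ ctrlSet U M) :
    ∃ w : ℝ → U, StronglyMeasurable w ∧ (∀ τ, ‖w τ‖ ≤ M) ∧ ∀ T, u =ᵐ[vol T] w := by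
  obtain ⟨w, hw, hwb, huw⟩ := exists_bounded_ae_eq M.2 hu.1 hu.2
  exact ⟨w, hw, hwb, fun T => ae_restrict_of_ae_restrict_of_subset Ioo_subset_Ioi_self huw⟩

theorem Admissible.exists_bounded_of_steers (hadm : Admissible B) {M : ℝ≥0} {u : ℝ → U} {t : ℝ≥0}
    {x : X} (hu : u ∈ ctrlSet U M) (h : Steers B t x u) :
    ∃ w : ℝ → U, StronglyMeasurable w ∧ (∀ τ, ‖w τ‖ ≤ M) ∧ S.op t x + ctrlMap B t w = 0 ∧
      u =ᵐ[vol t] w := by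
  obtain ⟨w, hw, hwb, huw⟩ := exists_bounded_of_mem_ctrlSet hu
  refine ⟨w, hw, hwb, ?_, huw t⟩
  rw [← ctrlMap_congr (huw t)]
  exact (hadm.steers_iff fun T =>
    (memLp_congr_ae (huw T)).2 (memLp_of_bounded hw hwb 2 T)).1 h

theorem Admissible.steers_of_bounded (hadm : Admissible B) {t : ℝ≥0} {x : X} {v : ℝ → U} {K : ℝ}
    (hv : StronglyMeasurable v) (hb : ∀ τ, ‖v τ‖ ≤ K) (h : S.op t x + ctrlMap B t v = 0) :
    Steers B t x v :=
  (hadm.steers_iff fun T => memLp_of_bounded hv hb 2 T).2 h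

theorem Admissible.exists_ctrlSet_steers (hadm : Admissible B) {t M : ℝ≥0} {x : X}
    (h : Steerable B t x M) : ∃ u ∈ ctrlSet U M, Steers B t x u := by
  obtain ⟨v, hv, hb, h0⟩ := h
  exact ⟨v, ⟨hv.aestronglyMeasurable, Eventually.of_forall hb⟩, hadm.steers_of_bounded hv hb h0⟩

/-! ### Duality: `L¹`-observability gives bounded null controls -/

/-- The test function is `v` restricted to `{K < ‖v‖}`: it gives `∫ ‖v‖ (‖v‖ - K) ≤ 0` over a set
where the integrand is positive. -/
theorem ae_norm_le_of_forall_inner_le {μ : Measure ℝ} {v : Lp U 2 μ} {K : ℝ}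
    (hK : 0 ≤ K) (h : ∀ f : Lp U 2 μ, inner ℝ v f ≤ K * ∫ τ, ‖f τ‖ ∂μ) [IsFiniteMeasure μ] :
    ∀ᵐ τ ∂μ, ‖v τ‖ ≤ K := by
  set A : Set ℝ := {τ | K < ‖v τ‖} with hA
  have hAm : MeasurableSet A :=
    measurableSet_lt measurable_const (Lp.stronglyMeasurable v).norm.measurable
  have hf : MemLp (A.indicator v) 2 μ := (Lp.memLp v).indicator hAm
  have hn : Integrable (fun τ => ‖A.indicator v τ‖) μ :=
    (memLp_one_iff_integrable.1 (hf.mono_exponent (by norm_num))).norm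
  have hi : Integrable (fun τ => inner ℝ (v τ) (A.indicator v τ)) μ :=
    integrable_inner_of_memLp (Lp.memLp v) hf
  have h1 : ∫ τ, inner ℝ (v τ) (A.indicator v τ) ∂μ ≤ ∫ τ, K * ‖A.indicator v τ‖ ∂μ := by
    have := h hf.toLp
    rw [integral_const_mul]
    rw [L2.inner_def] at this
    refine le_of_eq_of_le ?_ (this.trans_eq ?_)
    · refine integral_congr_ae ?_
      filter_upwards [hf.coeFn_toLp] with τ hτ
      rw [hτ]
    · congr 1
      refine integral_congr_ae ?_
      filter_upwards [hf.coeFn_toLp] with τ hτ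
      rw [hτ]
  have e : ∀ τ, inner ℝ (v τ) (A.indicator v τ) - K * ‖A.indicator v τ‖ =
      A.indicator (fun τ => ‖v τ‖ * (‖v τ‖ - K)) τ := by
    intro τ
    by_cases hτ : τ ∈ A
    · simp only [indicator_of_mem hτ, real_inner_self_eq_norm_mul_norm]; ring
    · simp [indicator_of_notMem hτ]
  have hpos : ∀ τ, 0 ≤ A.indicator (fun τ => ‖v τ‖ * (‖v τ‖ - K)) τ := fun τ =>
    indicator_nonneg (fun σ hσ => mul_nonneg (norm_nonneg _) (sub_nonneg.2 (le_of_lt hσ))) τ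
  have h2 : ∫ τ, A.indicator (fun τ => ‖v τ‖ * (‖v τ‖ - K)) τ ∂μ = 0 := by
    refine le_antisymm ?_ (integral_nonneg hpos)
    simp_rw [← e]
    rw [integral_sub hi (hn.const_mul K)]
    exact sub_nonpos.2 h1
  have h3 := (integral_eq_zero_iff_of_nonneg hpos
    ((hi.sub (hn.const_mul K)).congr (Eventually.of_forall e))).1 h2
  filter_upwards [h3] with τ hτ
  by_contra! hlt
  rw [indicator_of_mem (show τ ∈ A from hlt)] at hτ
  have : 0 < ‖v τ‖ * (‖v τ‖ - K) := mul_pos (hK.trans_lt hlt) (sub_pos.2 hlt)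
  exact this.ne' hτ

theorem integral_norm_Lp_le {μ : Measure ℝ} [IsFiniteMeasure μ] :
    ∃ c : ℝ, 0 ≤ c ∧ ∀ f : Lp U 2 μ, ∫ τ, ‖f τ‖ ∂μ ≤ c * ‖f‖ := by
  refine ⟨(μ univ ^ ((1 : ℝ) - 1 / 2)).toReal, ENNReal.toReal_nonneg, fun f => ?_⟩
  have h1 := eLpNorm_le_eLpNorm_mul_rpow_measure_univ (μ := μ) (p := 1) (q := 2) (f := f)
    (by norm_num) (Lp.aestronglyMeasurable f)
  have hf : MemLp f 1 μ := (Lp.memLp f).mono_exponent (by norm_num)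
  rw [integral_norm_eq_lintegral_enorm hf.1, ← eLpNorm_one_eq_lintegral_enorm, Lp.norm_def,
    mul_comm, ← ENNReal.toReal_mul]
  refine ENNReal.toReal_mono (ENNReal.mul_ne_top (Lp.eLpNorm_ne_top f) ?_) (by simpa using h1)
  exact ENNReal.rpow_ne_top_of_nonneg (by norm_num) (measure_ne_top _ _)

/-- If a linear functional on a subspace of `L²` is bounded by `K` times the `L¹`-norm, then it is
represented by a function with values in the ball of radius `K`. -/
theorem exists_Lp_of_le_integral_norm {μ : Measure ℝ} [IsFiniteMeasure μ] {V : Type*}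
    [AddCommGroup V] [Module ℝ V] (J : V →ₗ[ℝ] Lp U 2 μ) (φ : V →ₗ[ℝ] ℝ) {K : ℝ} (hK : 0 ≤ K)
    (h : ∀ z, |φ z| ≤ K * ∫ τ, ‖J z τ‖ ∂μ) :
    ∃ v : Lp U 2 μ, (∀ z, inner ℝ v (J z) = φ z) ∧ ∀ᵐ τ ∂μ, ‖v τ‖ ≤ K := by
  obtain ⟨c, hc, hcf⟩ := integral_norm_Lp_le (U := U) (μ := μ)
  have hnorm : ∃ C : ℝ, ∀ z, ‖φ z‖ ≤ C * ‖J z‖ := ⟨K * c, fun z => (h z).trans (by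
    rw [mul_assoc]; gcongr; exact hcf _)⟩
  have hint : ∀ f : Lp U 2 μ, Integrable (fun τ => ‖f τ‖) μ := fun f =>
    (memLp_one_iff_integrable.1 ((Lp.memLp f).mono_exponent (by norm_num))).norm
  -- The functional `J z ↦ φ z` is well defined because the bound forces `φ` to vanish on the kernel
  -- of `J`. Hahn–Banach is applied inside `L²` with the `L¹` norm as majorant, so Riesz represents
  -- the extension and the dual of `L¹` is not needed.
  obtain ⟨g, hg, hgN⟩ := exists_extension_of_le_sublinear
    ⟨LinearMap.range J, (φ.compLeftInverse J : LinearMap.range J →ₗ[ℝ] ℝ)⟩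
    (fun f => K * ∫ τ, ‖f τ‖ ∂μ)
    (by
      intro a ha f
      have : ∫ τ, ‖(a • f : Lp U 2 μ) τ‖ ∂μ = a * ∫ τ, ‖f τ‖ ∂μ := by
        rw [← integral_const_mul]
        refine integral_congr_ae ?_
        filter_upwards [Lp.coeFn_smul a f] with τ hτ
        rw [hτ, Pi.smul_apply, norm_smul, Real.norm_of_nonneg ha.le]
      rw [this]; ring)
    (by
      intro f f'
      rw [← mul_add, ← integral_add (hint f) (hint f')]
      refine mul_le_mul_of_nonneg_left ?_ hK
      refine integral_mono_ae (hint _) ((hint f).add (hint f')) ?_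
      filter_upwards [Lp.coeFn_add f f'] with τ hτ
      rw [hτ]
      exact norm_add_le _ _)
    (by
      rintro ⟨_, z, rfl⟩
      refine (le_of_eq ?_).trans ((le_abs_self _).trans (h z))
      exact LinearMap.compLeftInverse_apply_of_bdd φ J hnorm z _ rfl)
  have hgφ : ∀ z, g (J z) = φ z := fun z =>
    (hg ⟨J z, z, rfl⟩).trans (LinearMap.compLeftInverse_apply_of_bdd φ J hnorm z _ rfl)
  let G : StrongDual ℝ (Lp U 2 μ) := g.mkContinuous (K * c) fun f => by
    have hb : ∀ f, g f ≤ K * c * ‖f‖ := fun f => (hgN f).trans (by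
      rw [mul_assoc]; gcongr; exact hcf _)
    refine abs_le.2 ⟨?_, hb f⟩
    have := hb (-f)
    rw [map_neg, norm_neg] at this
    linarith
  have hG : ∀ f, inner ℝ ((InnerProductSpace.toDual ℝ _).symm G) f = g f := fun f => by
    rw [InnerProductSpace.toDual_symm_apply]; rfl
  refine ⟨(InnerProductSpace.toDual ℝ _).symm G, fun z => (hG _).trans (hgφ z), ?_⟩
  exact ae_norm_le_of_forall_inner_le hK fun f => (hG f).trans_le (hgN f)

/-- A null control must represent the functional `B* S*(T - ·) z ↦ -⟨x, S*(T) z⟩`. By (H3) this is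
bounded by `C ‖x‖` times the `L¹` norm of the observation, whence a representing control bounded by
`C ‖x‖`. -/
theorem H3.exists_steerable (h3 : H3 B) (hadm : Admissible B) {T : ℝ≥0} (hT : 0 < T) :
    ∃ C : ℝ, 0 < C ∧ ∀ x : X, Steerable B T x (C * ‖x‖) := by
  obtain ⟨C, hC, h⟩ := h3 T hT
  refine ⟨C, hC, fun x => ?_⟩
  let φ : S.DAdj →ₗ[ℝ] ℝ :=
    -((innerSL ℝ x).comp ((S.adjOp T).comp S.incl) : S.DAdj →ₗ[ℝ] ℝ)
  have hφ : ∀ z, φ z = -inner ℝ x (S.adjOp T (S.incl z)) := fun z => rfl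
  obtain ⟨v, hv, hvb⟩ := exists_Lp_of_le_integral_norm (obsLp B T) φ
    (K := C * ‖x‖) (by positivity) fun z => by
      have e : ∫ τ, ‖obsLp B T z τ‖ ∂(vol T) = ∫ τ, ‖obs B T z τ‖ ∂(vol T) := by
        refine integral_congr_ae ?_
        filter_upwards [(memLp_obs B 2 T T z).coeFn_toLp] with τ hτ
        rw [← hτ]; rfl
      rw [hφ, abs_neg, e]
      calc |inner ℝ x (S.adjOp T (S.incl z))| ≤ ‖x‖ * ‖S.adjOp T (S.incl z)‖ :=
            abs_real_inner_le_norm _ _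
        _ ≤ ‖x‖ * (C * ∫ τ, ‖obs B T z τ‖ ∂(vol T)) := by gcongr; exact h z
        _ = _ := by ring
  obtain ⟨w, hw, hwb, hvw⟩ := exists_bounded_ae_eq (by positivity)
    (Lp.aestronglyMeasurable v) hvb
  refine ⟨w, hw, hwb, S.ext_incl fun z => ?_⟩
  rw [inner_zero_left, ← ctrlMap_congr hvw, inner_add_left, ctrlMap_eq (Lp.memLp v),
    ContinuousLinearMap.adjoint_inner_left, Lp.toLp_coeFn, hadm.extObs_incl, ← inner_adjOp]
  have := hv z
  rw [hφ] at this
  rw [show (memLp_obs B 2 T T z).toLp = obsLp B T z from rfl, this]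
  abel

/-- Under null controllability with arbitrarily short times, waiting makes the problem strictly
cheaper. -/
theorem H3.exists_lt_steerable_add (h3 : H3 B) (hadm : Admissible B) {t r : ℝ≥0} (hr : 0 < r)
    {x : X} {M : ℝ} (hM : 0 < M) (h : Steerable B t x M) : ∃ K < M, Steerable B (t + r) x K := by
  obtain ⟨C, hC, hst⟩ := h3.exists_steerable hadm hr
  obtain ⟨v, hv, hb, h0⟩ := h
  set D := C * ‖S.op t x‖ with hD
  have hD0 : 0 ≤ D := by positivity
  -- Using `(1 - δ) v` up to time `t` leaves the state `δ S(t) x`, which is removed during the extra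
  -- time at cost `δ D`. This `δ` ensures `δ ≤ 1/2` and `δ D ≤ M / 2`, so that cost is at most `(1 -
  -- δ) M`.
  set δ := M / (2 * (D + M)) with hδ
  have hδ0 : 0 < δ := by positivity
  have hδ2 : δ ≤ 1 / 2 := by
    rw [hδ, div_le_div_iff₀ (by positivity) (by positivity)]; linarith
  have hδD : δ * D ≤ M / 2 := by
    rw [hδ, div_mul_eq_mul_div, div_le_div_iff₀ (by positivity) (by positivity)]
    nlinarith [mul_pos hM hM]
  have hvm := memLp_of_bounded hv hb 2 t
  have hstate : S.op t x + ctrlMap B t ((1 - δ) • v) = δ • S.op t x := by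
    rw [ctrlMap_smul _ hvm, eq_neg_of_add_eq_zero_right h0]
    module
  have hs := hst (δ • S.op t x)
  rw [← hstate] at hs
  refine ⟨(1 - δ) * M, by nlinarith, (Steerable.concat hadm (hv.const_smul (1 - δ))
    (K := (1 - δ) * M) (fun τ => ?_) hs).mono (max_le le_rfl ?_)⟩
  · rw [Pi.smul_apply, norm_smul, Real.norm_of_nonneg (by linarith)]
    exact mul_le_mul_of_nonneg_left (hb τ) (by linarith)
  · rw [hstate, norm_smul, Real.norm_of_nonneg hδ0.le]
    nlinarith

/-- If the bound is not saturated, then null control is possible in a shorter time. -/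
theorem H3.exists_steerable_sub (h3 : H3 B) (hadm : Admissible B) {T : ℝ≥0} (hT : 0 < T) {x : X}
    {K M : ℝ} (hKM : K < M) (h : Steerable B T x K) : ∃ t < T, 0 < t ∧ Steerable B t x M := by
  obtain ⟨C, hC, hst⟩ := h3.exists_steerable hadm (half_pos hT)
  obtain ⟨v, hv, hb, h0⟩ := h
  have hvm := memLp_of_bounded hv hb 2 T
  have hc : ContinuousWithinAt (fun s => C * ‖x - (S.op s x + ctrlMap B s v)‖) (Icc 0 T) 0 := by
    have h1 := (hadm.isSolOn x hvm).1 0 ⟨le_rfl, hT.le⟩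
    exact ((continuousWithinAt_const.sub h1).norm).const_mul C
  have hz : C * ‖x - (S.op 0 x + ctrlMap B 0 v)‖ < M - K := by
    rw [op_zero_apply, ctrlMap_zero_time]
    simpa using hKM
  -- The first `s` units of time are to be skipped; `s > 0` makes the gain strict, and `s < T / 2`
  -- leaves at least `T / 2` for the correction.
  have hev := (hc.tendsto.eventually_lt_const hz).filter_mono
    (nhdsWithin_mono 0 (Ioc_subset_Icc_self))
  have : (𝓝[Ioc 0 T] (0 : ℝ≥0)).NeBot := by
    rw [nhdsWithin_Ioc_eq_nhdsGT hT]; infer_instance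
  obtain ⟨s, hs, hs0, hsT⟩ := (hev.and ((eventually_mem_nhdsWithin).and
    (mem_nhdsWithin_of_mem_nhds (Iio_mem_nhds (half_pos hT))))).exists
  obtain ⟨r, hr⟩ := exists_add_of_le hs0.2
  have hrT : T / 2 ≤ r := by
    by_contra! hlt
    have := add_lt_add (show s < T / 2 from hsT) hlt
    rw [← hr, add_halves] at this
    exact lt_irrefl _ this
  refine ⟨r, ?_, (half_pos hT).trans_le hrT, ?_⟩
  · rw [hr]; exact lt_add_of_pos_left _ hs0.1
  · rw [hr] at h0
    -- The tail of `v` steers the state at time `s` to zero at cost `K`; the difference between `x`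
    -- and that state costs less than `M - K`. By linearity their sum steers `x` itself.
    have h1 := hadm.steerable_tail hv hb h0
    have h2 := (hst (x - (S.op s x + ctrlMap B s v))).mono_time hadm hrT
    have := h1.add h2
    rw [add_sub_cancel] at this
    exact this.mono (by linarith)

/-! ### Approximate controllability by controls with a small support -/

theorem Admissible.isExtObs (hadm : Admissible B) (T : ℝ≥0) (z : X) :
    IsExtObs B T z (extObs B T z) := by
  refine ⟨Lp.memLp _, ?_⟩
  obtain ⟨y, hy, hyz⟩ := mem_closure_iff_seq_limit.1 (S.denseRange_incl z)
  choose zn hzn using hy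
  refine ⟨zn, by simpa only [hzn] using hyz, ?_⟩
  have h1 : Tendsto (fun n => extObs B T (S.incl (zn n))) atTop (𝓝 (extObs B T z)) := by
    simp only [hzn]
    exact ((extObs B T).continuous.tendsto z).comp hyz
  rw [Lp.tendsto_Lp_iff_tendsto_eLpNorm'] at h1
  refine h1.congr fun n => eLpNorm_congr_ae ?_
  rw [hadm.extObs_incl]
  filter_upwards [(memLp_obs B 2 T T (zn n)).coeFn_toLp] with τ hτ
  rw [Pi.sub_apply, hτ]

variable (B) in
/-- The states reached at time `s` by the bounded controls that vanish outside `E`. -/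
def reachable (s : ℝ≥0) (E : Set ℝ) : Submodule ℝ X where
  carrier := {x | ∃ w : ℝ → U, StronglyMeasurable w ∧ (∃ R, ∀ τ, ‖w τ‖ ≤ R) ∧ (∀ τ ∉ E, w τ = 0) ∧
    ctrlMap B s w = x}
  add_mem' := by
    rintro _ _ ⟨w, hw, ⟨R, hR⟩, h0, rfl⟩ ⟨w', hw', ⟨R', hR'⟩, h0', rfl⟩
    exact ⟨w + w', hw.add hw', ⟨R + R', fun τ => norm_add_le_of_le (hR τ) (hR' τ)⟩,
      fun τ hτ => by simp [h0 τ hτ, h0' τ hτ],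
      ctrlMap_add (memLp_of_bounded hw hR 2 s) (memLp_of_bounded hw' hR' 2 s)⟩
  zero_mem' := ⟨0, stronglyMeasurable_zero, ⟨0, by simp⟩, fun _ _ => rfl, ctrlMap_zero s⟩
  smul_mem' := by
    rintro c _ ⟨w, hw, ⟨R, hR⟩, h0, rfl⟩
    refine ⟨c • w, hw.const_smul c, ⟨‖c‖ * R, fun τ => ?_⟩,
      fun τ hτ => by simp [h0 τ hτ], ctrlMap_smul c (memLp_of_bounded hw hR 2 s)⟩
    rw [Pi.smul_apply, norm_smul]
    exact mul_le_mul_of_nonneg_left (hR τ) (norm_nonneg c)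

/-- If `z` is orthogonal to everything reachable through `E`, its extended observation vanishes a.e.
on `E`, hence a.e. on `(0, s)` by (H4), so `z` is orthogonal to every reached state. -/
theorem H4.ctrlMap_mem_closure (h4 : H4 B) (hadm : Admissible B) {s : ℝ≥0} (hs : 0 < s)
    {E : Set ℝ} (hE : MeasurableSet E) (hEs : E ⊆ Ioo 0 (s : ℝ)) (hE0 : 0 < volume E) {v : ℝ → U}
    (hv : MemLp v 2 (vol s)) : ctrlMap B s v ∈ (reachable B s E).topologicalClosure := by
  rw [← Submodule.orthogonal_orthogonal_eq_closure, Submodule.mem_orthogonal']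
  intro z hz
  set f := extObs B s z with hf
  have hfm : StronglyMeasurable f := Lp.stronglyMeasurable f
  have hfE : ∀ᵐ τ ∂(volume.restrict E), f τ = 0 := by
    -- The observation `f` is only in `L²`; truncating at height `n` turns it into a bounded test
    -- control.
    have hn : ∀ n : ℕ, ∀ᵐ τ ∂(vol s), τ ∈ E → ‖f τ‖ ≤ n → f τ = 0 := by
      intro n
      set F := E ∩ {τ | ‖f τ‖ ≤ n} with hF
      have hFm : MeasurableSet F :=
        hE.inter (measurableSet_le hfm.norm.measurable measurable_const)
      have hw : StronglyMeasurable (F.indicator f) := hfm.indicator hFm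
      have hwb : ∀ τ, ‖F.indicator f τ‖ ≤ n := by
        intro τ
        by_cases hτ : τ ∈ F
        · rw [indicator_of_mem hτ]; exact hτ.2
        · rw [indicator_of_notMem hτ]; simp
      have hmem : ctrlMap B s (F.indicator f) ∈ reachable B s E :=
        ⟨_, hw, ⟨n, hwb⟩, fun τ hτ => indicator_of_notMem (fun h => hτ h.1) _, rfl⟩
      have h0 := (Submodule.mem_orthogonal _ _).1 hz _ hmem
      have hwm := memLp_of_bounded hw hwb 2 s
      rw [inner_ctrlMap hwm, ← hf] at h0
      have hpos : ∀ τ, 0 ≤ inner ℝ (F.indicator f τ) (f τ) := by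
        intro τ
        by_cases hτ : τ ∈ F
        · rw [indicator_of_mem hτ]; exact real_inner_self_nonneg
        · rw [indicator_of_notMem hτ, inner_zero_left]
      have h1 := (integral_eq_zero_iff_of_nonneg hpos
        (integrable_inner_of_memLp hwm (Lp.memLp f))).1 h0
      filter_upwards [h1] with τ hτ hτE hτn
      rw [indicator_of_mem (show τ ∈ F from ⟨hτE, hτn⟩)] at hτ
      exact inner_self_eq_zero.1 hτ
    have h2 := (ae_mono (Measure.restrict_mono hEs le_rfl)) (ae_all_iff.2 hn)
    filter_upwards [h2, ae_restrict_mem hE] with τ hτ hτE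
    obtain ⟨n, hn'⟩ := exists_nat_ge ‖f τ‖
    exact hτ n hτE hn'
  have h0 := h4 z s f hs (hadm.isExtObs s z) E hE hEs hE0 hfE
  rw [inner_ctrlMap hv, ← hf]
  refine integral_eq_zero_of_ae ?_
  filter_upwards [h0] with τ hτ
  rw [hτ, inner_zero_right]; rfl

/-- A bounded null control whose norm is not a.e. equal to the bound is not optimal. -/
theorem H4.exists_lt_steerable (h4 : H4 B) (h3 : H3 B) (hadm : Admissible B) {T : ℝ≥0} {x : X}
    {v : ℝ → U} {M : ℝ} (hM : 0 < M) (hv : StronglyMeasurable v) (hb : ∀ τ, ‖v τ‖ ≤ M)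
    (h0 : S.op T x + ctrlMap B T v = 0) (hne : ¬ ∀ᵐ τ ∂(vol T), ‖v τ‖ = M) :
    ∃ K < M, Steerable B T x K := by
  -- On `E n` the control has slack `1 / (n + 1)`, and `E n` also stops that long before `T`,
  -- leaving time for a final correction.
  let E : ℕ → Set ℝ := fun n =>
    {τ | ‖v τ‖ ≤ M - 1 / ((n : ℝ) + 1)} ∩ Ioo 0 ((T : ℝ) - 1 / ((n : ℝ) + 1))
  obtain ⟨n, hn⟩ : ∃ n, 0 < volume (E n) := by
    by_contra! hall
    refine hne ((ae_restrict_iff' measurableSet_Ioo).2 ?_)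
    have h1 : ∀ᵐ τ : ℝ, ∀ n, τ ∉ E n := ae_all_iff.2 fun n =>
      measure_eq_zero_iff_ae_notMem.1 (le_zero_iff.1 (hall n))
    filter_upwards [h1] with τ hτ hτT
    by_contra hlt
    have hlt' : ‖v τ‖ < M := lt_of_le_of_ne (hb τ) hlt
    obtain ⟨n, hn⟩ := exists_nat_one_div_lt (lt_min (sub_pos.2 hlt') (sub_pos.2 hτT.2))
    refine hτ n ⟨?_, hτT.1, ?_⟩
    · have := hn.trans_le (min_le_left _ _)
      rw [mem_ofPred_eq]
      linarith
    · have := hn.trans_le (min_le_right _ _)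
      linarith
  set ε : ℝ := 1 / ((n : ℝ) + 1) with hε
  have hε0 : 0 < ε := by positivity
  have hEm : MeasurableSet (E n) :=
    (measurableSet_le hv.norm.measurable measurable_const).inter measurableSet_Ioo
  obtain ⟨τ₀, -, hτ₀⟩ := nonempty_of_measure_ne_zero hn.ne'
  have hTε : 0 < (T : ℝ) - ε := hτ₀.1.trans hτ₀.2
  obtain ⟨s, hsε⟩ : ∃ s : ℝ≥0, (s : ℝ) = T - ε := ⟨⟨_, hTε.le⟩, rfl⟩
  have hs0 : 0 < s := by rw [← NNReal.coe_pos, hsε]; exact hTε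
  have hsT : s < T := by rw [← NNReal.coe_lt_coe, hsε]; linarith
  obtain ⟨r, rfl⟩ := exists_add_of_le hsT.le
  have hr0 : 0 < r := by simpa using hsT
  have hEs : E n ⊆ Ioo 0 (s : ℝ) := by
    rw [hsε]; exact inter_subset_right
  obtain ⟨C, hC, hst⟩ := h3.exists_steerable hadm hr0
  obtain ⟨_, _, hst'⟩ := h3.exists_steerable hadm hs0
  -- By (H3) the target `-S(s) x` is a reached state, so controls supported in `E n` approximate it.
  -- The tolerance `M / (2 C)` keeps the final correction below `M / 2`.
  obtain ⟨v₀, hv₀, hvb₀, hv₀0⟩ := hst' x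
  obtain ⟨-, ⟨w, hw, ⟨R, hR⟩, hwE, rfl⟩, hdist⟩ := Metric.mem_closure_iff.1
    (h4.ctrlMap_mem_closure hadm hs0 hEm hEs hn (memLp_of_bounded hv₀ hvb₀ 2 s))
    (M / (2 * C)) (by positivity)
  have hstate : ‖S.op s x + ctrlMap B s w‖ ≤ M / (2 * C) := by
    rw [eq_neg_of_add_eq_zero_left hv₀0, neg_add_eq_sub, ← dist_eq_norm, dist_comm]
    exact hdist.le
  obtain ⟨c, hc, hcb, hc0⟩ := (hst (S.op s x + ctrlMap B s w)).mono (L := M / 2) (by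
    calc C * ‖S.op s x + ctrlMap B s w‖ ≤ C * (M / (2 * C)) := by gcongr
      _ = M / 2 := by field_simp)
  have hwm := memLp_of_bounded hw hR 2 s
  have hcm := memLp_of_bounded hc hcb 2 r
  have hq0 := hadm.op_add_ctrlMap_concat hwm hcm x
  rw [hc0] at hq0
  have hR0 : 0 ≤ R := (norm_nonneg _).trans (hR 0)
  obtain ⟨δ, hδ0, hδ1, hδR⟩ : ∃ δ : ℝ, 0 < δ ∧ δ ≤ 1 ∧ δ * R ≤ ε / 2 := by
    refine ⟨min 1 (ε / (2 * (R + 1))), by positivity, min_le_left _ _, ?_⟩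
    calc min 1 (ε / (2 * (R + 1))) * R ≤ ε / (2 * (R + 1)) * (R + 1) := by
          gcongr
          · exact min_le_right _ _
          · linarith
      _ = ε / 2 := by field_simp
  -- A convex combination of null controls is a null control. On `E n` the slack `ε` absorbs `δ R ≤
  -- ε / 2`; elsewhere the second control is at most `M / 2`, which gives `(1 - δ) M + δ M / 2`.
  refine ⟨max (M - ε / 2) (M - δ * M / 2), max_lt (by linarith) (by nlinarith),
    (1 - δ) • v + δ • concat s w c,
    (hv.const_smul _).add ((stronglyMeasurable_concat s hw hc).const_smul _), fun τ => ?_, ?_⟩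
  · have hle : ∀ a : ℝ, ‖concat s w c τ‖ ≤ a →
        ‖((1 - δ) • v + δ • concat s w c) τ‖ ≤ (1 - δ) * ‖v τ‖ + δ * a := by
      intro a ha
      refine (norm_add_le _ _).trans ?_
      rw [Pi.smul_apply, Pi.smul_apply, norm_smul, norm_smul, Real.norm_of_nonneg hδ0.le,
        Real.norm_of_nonneg (sub_nonneg.2 hδ1)]
      gcongr
    by_cases hτE : τ ∈ E n
    · have hτs : τ < s := (hEs hτE).2
      have hvτ : ‖v τ‖ ≤ M - ε := hτE.1
      refine (hle R ?_).trans (le_max_of_le_left ?_)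
      · rw [concat, if_pos hτs]; exact hR τ
      · have : (1 - δ) * ‖v τ‖ ≤ ‖v τ‖ := mul_le_of_le_one_left (norm_nonneg _) (by linarith)
        linarith
    · refine (hle (M / 2) ?_).trans (le_max_of_le_right ?_)
      · rw [concat]
        split_ifs
        · rw [hwE τ hτE, norm_zero]; positivity
        · exact hcb _
      · have : (1 - δ) * ‖v τ‖ ≤ (1 - δ) * M :=
          mul_le_mul_of_nonneg_left (hb τ) (sub_nonneg.2 hδ1)
        linarith
  · have hvm := memLp_of_bounded hv hb 2 (s + r)
    have hqm := memLp_concat hwm hcm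
    rw [ctrlMap_add (hvm.const_smul _) (hqm.const_smul _), ctrlMap_smul _ hvm, ctrlMap_smul _ hqm,
      eq_neg_of_add_eq_zero_right h0, eq_neg_of_add_eq_zero_right hq0]
    module

/-! ### The functions `T⁰`, `T¹` and `N` -/

/-- An orbit that vanishes once stays zero, and continuity from the right shows that the infimum is
attained. -/
theorem op_eq_zero_iff_T1_le {T : ℝ≥0} {y : X} : S.op T y = 0 ↔ S.T1 y ≤ T := by
  refine ⟨fun h => iInf₂_le T h, fun h => ?_⟩
  have hgt : ∀ s > T, S.op s y = 0 := by
    intro s hs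
    have hlt : S.T1 y < s := h.trans_lt (ENNReal.coe_lt_coe.2 hs)
    rw [T1] at hlt
    simp only [iInf_lt_iff] at hlt
    obtain ⟨t, ht, hts⟩ := hlt
    obtain ⟨r, rfl⟩ := exists_add_of_le (ENNReal.coe_lt_coe.1 hts).le
    rw [add_comm, op_add_apply, ht, map_zero]
  have h1 : Tendsto (fun s => S.op s y) (𝓝[>] T) (𝓝 (S.op T y)) :=
    ((S.continuous_op y).tendsto T).mono_left nhdsWithin_le_nhds
  refine tendsto_nhds_unique h1 (tendsto_const_nhds.congr' ?_)
  filter_upwards [self_mem_nhdsWithin] with s hs using (hgt s hs).symm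

theorem T1_ne_zero {y : X} (hy : y ≠ 0) : S.T1 y ≠ 0 := by
  intro h
  have := op_eq_zero_iff_T1_le.2 (show S.T1 y ≤ (0 : ℝ≥0) by simp [h])
  rw [op_zero_apply] at this
  exact hy this

theorem Admissible.minNorm_eq_zero (hadm : Admissible B) {T : ℝ≥0} {y : X} (h : S.T1 y ≤ T) :
    minNorm B T y = 0 := by
  have := hadm.minNorm_le (op_eq_zero_steerable (B := B) (op_eq_zero_iff_T1_le.2 h))
  simpa using this

theorem Admissible.NT1_of_T1_eq_top (hadm : Admissible B) {y : X} (h : S.T1 y = ∞) :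
    NT1 B y = ⨅ T : ℝ≥0, minNorm B T y := by
  rw [NT1, minNormExt, if_pos h]
  exact (tendsto_atTop_iInf (hadm.minNorm_antitone y)).limUnder_eq

theorem Admissible.NT1_of_T1_ne_top (hadm : Admissible B) {y : X} (hy : y ≠ 0)
    (h : S.T1 y ≠ ∞) : NT1 B y = 0 := by
  rw [NT1, minNormExt, if_neg h, if_neg (T1_ne_zero hy)]
  exact hadm.minNorm_eq_zero (ENNReal.coe_toNNReal h).ge

theorem H3.T0_eq_zero (h3 : H3 B) (hadm : Admissible B) (y : X) : T0 B y = 0 := by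
  refine le_zero_iff.1 (le_of_forall_gt fun c hc => ?_)
  obtain ⟨t, ht0, htc⟩ := ENNReal.lt_iff_exists_nnreal_btwn.1 hc
  refine lt_of_le_of_lt ?_ htc
  obtain ⟨C, -, hC⟩ := h3.exists_steerable hadm (ENNReal.coe_pos.1 ht0)
  obtain ⟨v, hv, hb, h0⟩ := hC y
  exact iInf₂_le t ⟨v, memLp_top_of_bound hv.aestronglyMeasurable _ (Eventually.of_forall hb),
    hadm.steers_of_bounded hv hb h0⟩

theorem Admissible.tendsto_minNorm_zero (hadm : Admissible B) {y : X} (hy : y ≠ 0) :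
    Tendsto (fun T : ℝ≥0 => minNorm B T y) (𝓝[>] 0) (𝓝 ∞) := by
  refine ENNReal.tendsto_nhds_top_iff_nnreal.2 fun a => ?_
  filter_upwards [nhdsWithin_le_nhds (hadm.eventually_not_steerable hy (a + 1))] with t ht
  by_contra! hle
  refine ht (hadm.steerable_of_minNorm_lt (hle.trans_lt ?_))
  rw [← ENNReal.ofReal_coe_nnreal, ENNReal.ofReal_lt_ofReal_iff (by positivity)]
  exact lt_add_one _

theorem H3.NT0_eq_top (h3 : H3 B) (hadm : Admissible B) {y : X} (hy : y ≠ 0) : NT0 B y = ∞ := by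
  rw [NT0, h3.T0_eq_zero hadm, minNormExt, if_neg ENNReal.zero_ne_top, if_pos rfl]
  exact (hadm.tendsto_minNorm_zero hy).limUnder_eq

/-! ### The decompositions -/

theorem H3.dom_eq_union_W (h3 : H3 B) (hadm : Admissible B) : dom X = W32 B ∪ W33 B := by
  ext ⟨T, y⟩
  refine ⟨fun h => ?_, fun h => h.elim (fun h => h.1.1) (fun h => h.1.1)⟩
  have hW : (T, y) ∈ W3 B := ⟨h, h3.NT0_eq_top hadm h.2⟩
  have h0 := h3.T0_eq_zero hadm y
  have hlt : T0 B y < ∞ := by rw [h0]; exact ENNReal.zero_lt_top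
  have hltT : T0 B y < T := by rw [h0]; exact ENNReal.coe_pos.2 h.1
  exact (lt_or_ge (T : ℝ≥0∞) (S.T1 y)).imp (fun h => ⟨hW, hlt, hltT, h⟩)
    (fun h => ⟨hW, hlt, hltT, h⟩)

theorem H3.dom_eq_union_V (h3 : H3 B) (hadm : Admissible B) : dom X = V31 B ∪ V32 B := by
  ext ⟨M, y⟩
  refine ⟨fun h => ?_, fun h => h.elim (fun h => h.1.1) (fun h => h.1.1)⟩
  have hV : (M, y) ∈ V3 B := ⟨h, h3.NT0_eq_top hadm h.2⟩
  have hlt : T0 B y < ∞ := by rw [h3.T0_eq_zero hadm]; exact ENNReal.zero_lt_top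
  exact (le_or_gt (M : ℝ≥0∞) (NT1 B y)).imp (fun h => ⟨hV, hlt, h⟩) (fun h => ⟨hV, hlt, h⟩)

theorem H3.gamma1_eq_empty (h3 : H3 B) (hadm : Admissible B) : gamma1 B = ∅ :=
  eq_empty_of_forall_notMem fun _ h => h.2.2.2.ne (h3.NT0_eq_top hadm h.1.2)

theorem H3.W22_eq_empty (h3 : H3 B) (hadm : Admissible B) : W22 B = ∅ :=
  eq_empty_of_forall_notMem fun _ h => h.1.2.2.ne (h3.NT0_eq_top hadm h.1.1.2)

theorem H3.gamma2_eq_empty (h3 : H3 B) (hadm : Admissible B) : gamma2 B = ∅ :=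
  eq_empty_of_forall_notMem fun _ h => h.2.2.2.1.ne (h3.NT0_eq_top hadm h.1.2)

theorem H3.V23_eq_empty (h3 : H3 B) (hadm : Admissible B) : V23 B = ∅ :=
  eq_empty_of_forall_notMem fun _ h => h.1.2.2.ne (h3.NT0_eq_top hadm h.1.1.2)

/-! ### The minimal time problem -/

/-- If `T¹ = ∞`, then `N₁` is the infimum of `N`, and waiting one more unit of time would push `N`
below `M ≤ N₁`. If `T¹ < ∞`, then `N₁ = 0 < M`. -/
theorem H3.not_exists_tpAdm (h3 : H3 B) (hadm : Admissible B) {M : ℝ≥0} {y : X} (hM : 0 < M)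
    (hy : y ≠ 0) (hle : (M : ℝ≥0∞) ≤ NT1 B y) : ¬ ∃ u, TPAdm B M y u := by
  rintro ⟨u, hu, t, -, hut⟩
  by_cases h : S.T1 y = ∞
  · obtain ⟨w, hw, hwb, hw0, -⟩ := hadm.exists_bounded_of_steers hu hut
    obtain ⟨K, hK, hst⟩ := h3.exists_lt_steerable_add hadm one_pos (NNReal.coe_pos.2 hM)
      ⟨w, hw, hwb, hw0⟩
    rw [hadm.NT1_of_T1_eq_top h] at hle
    have h1 := (hle.trans (iInf_le _ (t + 1))).trans (hadm.minNorm_le hst)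
    rw [← ENNReal.ofReal_coe_nnreal, ENNReal.ofReal_le_ofReal_iff hst.nonneg] at h1
    exact absurd h1 (not_le.2 hK)
  · rw [hadm.NT1_of_T1_ne_top hy h] at hle
    exact hM.ne' (by simpa using hle)

theorem Admissible.exists_tpAdm (hadm : Admissible B) {M : ℝ≥0} {y : X} (hy : y ≠ 0)
    (hlt : NT1 B y < M) : ∃ u, TPAdm B M y u := by
  obtain ⟨t, ht, hst⟩ : ∃ t : ℝ≥0, 0 < t ∧ Steerable B t y M := by
    by_cases h : S.T1 y = ∞
    · rw [hadm.NT1_of_T1_eq_top h, iInf_lt_iff] at hlt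
      obtain ⟨t, ht⟩ := hlt
      rw [← ENNReal.ofReal_coe_nnreal] at ht
      -- The infimum also ranges over `t = 0`; adding one guarantees a positive time.
      exact ⟨t + 1, by positivity, (hadm.steerable_of_minNorm_lt ht).add_time hadm 1⟩
    · refine ⟨(S.T1 y).toNNReal, ENNReal.toNNReal_pos (T1_ne_zero hy) h, ?_⟩
      exact (op_eq_zero_steerable (op_eq_zero_iff_T1_le.2 (ENNReal.coe_toNNReal h).ge)).mono M.2
  obtain ⟨u, hu, hs⟩ := hadm.exists_ctrlSet_steers hst
  exact ⟨u, hu, t, ht, hs⟩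

/-- A minimal time control that is not saturated can be replaced by one with a bound `K < M`, and
this slack buys a strictly earlier arrival. -/
theorem H4.norm_eq_of_isMinTimeControl (h4 : H4 B) (h3 : H3 B) (hadm : Admissible B) {M : ℝ≥0}
    {y : X} (hM : 0 < M) (hy : y ≠ 0) {u : ℝ → U} (hu : IsMinTimeControl B M y u) :
    ∀ᵐ t ∂(vol (minTime B M y).toNNReal), ‖u t‖ = M := by
  obtain ⟨huM, t, ht, hut, -⟩ := hu
  rw [← ht, ENNReal.toNNReal_coe]
  obtain ⟨w, hw, hwb, hw0, huw⟩ := hadm.exists_bounded_of_steers huM hut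
  by_contra hne
  have ht0 : 0 < t := by
    refine pos_iff_ne_zero.2 ?_
    rintro rfl
    rw [op_zero_apply, ctrlMap_zero_time, add_zero] at hw0
    exact hy hw0
  obtain ⟨K, hK, hst⟩ := h4.exists_lt_steerable h3 hadm (NNReal.coe_pos.2 hM) hw hwb hw0
    fun h => hne (by filter_upwards [h, huw] with τ h1 h2; rw [h2, h1])
  obtain ⟨t', htt, ht', hst'⟩ := h3.exists_steerable_sub hadm ht0 hK hst
  have : minTime B M y ≤ t' := iInf₂_le t' ⟨ht', hadm.exists_ctrlSet_steers hst'⟩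
  rw [← ht, ENNReal.coe_le_coe] at this
  exact absurd this (not_le.2 htt)

/-! ### The minimal norm problem -/

theorem Admissible.isMinNormControl_zero (hadm : Admissible B) {T : ℝ≥0} {y : X}
    (h : S.T1 y ≤ T) : IsMinNormControl B T y (fun _ => 0) := by
  refine ⟨hadm.npAdm_of_bounded (K := 0) stronglyMeasurable_zero (by simp) ?_, ?_⟩
  · rw [op_eq_zero_iff_T1_le.2 h, zero_add]
    exact ctrlMap_zero T
  · rw [hadm.minNorm_eq_zero h]
    exact eLpNorm_zero

theorem Admissible.ae_eq_zero_of_isMinNormControl (hadm : Admissible B) {T : ℝ≥0} {y : X}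
    (h : S.T1 y ≤ T) {v : ℝ → U} (hv : IsMinNormControl B T y v) : ∀ᵐ t ∂(vol T), v t = 0 := by
  have h0 := hv.2
  rw [hadm.minNorm_eq_zero h, eLpNorm_eq_zero_iff hv.1.1.1 ENNReal.top_ne_zero] at h0
  exact h0

theorem Admissible.npBangBang_of_T1_le (hadm : Admissible B) {T : ℝ≥0} {y : X}
    (h : S.T1 y ≤ T) : NPBangBang B T y := by
  refine ⟨⟨_, (hadm.isMinNormControl_zero h).1⟩, fun v hv => ?_⟩
  filter_upwards [hadm.ae_eq_zero_of_isMinNormControl h hv] with t ht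
  rw [ht, hadm.minNorm_eq_zero h, enorm_zero]

theorem Admissible.not_isMinNormControl_zero (hadm : Admissible B) {T : ℝ≥0} {y : X}
    (h : T < S.T1 y) : ¬ IsMinNormControl B T y (fun _ => 0) := by
  intro h0
  have := (hadm.steersOn_iff MemLp.zero').1 h0.1.2
  rw [show (fun _ : ℝ => (0 : U)) = 0 from rfl, ctrlMap_zero, add_zero] at this
  exact absurd (op_eq_zero_iff_T1_le.1 this) (not_le.2 h)

theorem H4.npBangBang (h4 : H4 B) (h3 : H3 B) (hadm : Admissible B) {T : ℝ≥0} {y : X}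
    (hT : 0 < T) (h : T < S.T1 y) : NPBangBang B T y := by
  obtain ⟨C, hC, hst⟩ := h3.exists_steerable hadm hT
  have hfin : minNorm B T y ≠ ∞ := ne_top_of_le_ne_top ENNReal.ofReal_ne_top
    (hadm.minNorm_le (hst y))
  refine ⟨?_, fun v hv => ?_⟩
  · obtain ⟨v, hvm, hb, h0⟩ := hst y
    exact ⟨v, hadm.npAdm_of_bounded hvm hb h0⟩
  set M := (minNorm B T y).toReal with hM
  have hMN : ENNReal.ofReal M = minNorm B T y := ENNReal.ofReal_toReal hfin
  -- If the minimal norm were zero, arbitrarily small controls would steer `y` to zero, forcing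
  -- `S(T) y = 0` against `T < T¹`.
  have hM0 : 0 < M := by
    refine ENNReal.toReal_pos (fun h0 => ?_) hfin
    refine absurd (op_eq_zero_iff_T1_le.1 (hadm.op_eq_zero_of_steerable fun K hK => ?_))
      (not_le.2 h)
    refine hadm.steerable_of_minNorm_lt ?_
    rw [h0]
    exact ENNReal.ofReal_pos.2 hK
  obtain ⟨w, hw, hwb, hw0, hvw⟩ := hadm.exists_bounded_of_npAdm hM0.le hv.1 (hv.2.trans hMN.symm).le
  have hbang : ∀ᵐ τ ∂(vol T), ‖w τ‖ = M := by
    by_contra hne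
    obtain ⟨K, hK, hstK⟩ := h4.exists_lt_steerable h3 hadm hM0 hw hwb hw0 hne
    have := hadm.minNorm_le hstK
    rw [← hMN, ENNReal.ofReal_le_ofReal_iff hstK.nonneg] at this
    exact absurd this (not_le.2 hK)
  filter_upwards [hbang, hvw] with τ h1 h2
  rw [h2, ← ofReal_norm, h1, hMN]

end C0Semigroup

end

theorem theorem1p3 {X : Type*} [NormedAddCommGroup X] [InnerProductSpace ℝ X] [CompleteSpace X]
    {U : Type*} [NormedAddCommGroup U] [InnerProductSpace ℝ U] [CompleteSpace U]
    (S : C0Semigroup X) (B : U →L[ℝ] S.Xneg) (hB : B ≠ 0) (hadm : C0Semigroup.Admissible B) :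
    -- (i)
    (C0Semigroup.H3 B →
      C0Semigroup.dom X = C0Semigroup.W32 B ∪ C0Semigroup.W33 B ∧
      C0Semigroup.dom X = C0Semigroup.V31 B ∪ C0Semigroup.V32 B ∧
      C0Semigroup.gamma1 B = C0Semigroup.W22 B ∧ C0Semigroup.W22 B = ∅ ∧
      C0Semigroup.gamma2 B = C0Semigroup.V23 B ∧ C0Semigroup.V23 B = ∅) ∧
    -- (ii)
    (C0Semigroup.H3 B →
      (∀ M y₀, (M, y₀) ∈ C0Semigroup.V31 B →
        (¬ ∃ u, C0Semigroup.TPAdm B M y₀ u) ∧ ¬ C0Semigroup.TPBangBang B M y₀) ∧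
      (C0Semigroup.H4 B →
        ∀ M y₀, (M, y₀) ∈ C0Semigroup.V32 B → C0Semigroup.TPBangBang B M y₀)) ∧
    -- (iii)
    ((∀ T y₀, (T, y₀) ∈ C0Semigroup.W33 B →
        C0Semigroup.NullIsUniqueMinNormControl B T y₀ ∧ C0Semigroup.NPBangBang B T y₀) ∧
      (C0Semigroup.H3 B → C0Semigroup.H4 B →
        ∀ T y₀, (T, y₀) ∈ C0Semigroup.W32 B →
          C0Semigroup.NPBangBang B T y₀ ∧
          ¬ C0Semigroup.IsMinNormControl B T y₀ (fun _ => 0))) := by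

  refine ⟨fun h3 => ?_, fun h3 => ⟨fun M y h => ?_, fun h4 M y h => ?_⟩,
    fun T y h => ?_, fun h3 h4 T y h => ?_⟩
  · rw [h3.gamma1_eq_empty hadm, h3.W22_eq_empty hadm, h3.gamma2_eq_empty hadm,
      h3.V23_eq_empty hadm]
    exact ⟨h3.dom_eq_union_W hadm, h3.dom_eq_union_V hadm, rfl, rfl, rfl, rfl⟩
  · have hno := h3.not_exists_tpAdm hadm h.1.1.1 h.1.1.2 h.2.2
    exact ⟨hno, fun hbb => hno hbb.1⟩
  · exact ⟨hadm.exists_tpAdm h.1.1.2 h.2.2,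
      fun u hu => h4.norm_eq_of_isMinTimeControl h3 hadm h.1.1.1 h.1.1.2 hu⟩
  · exact ⟨⟨hadm.isMinNormControl_zero h.2.2.2,
      fun v hv => hadm.ae_eq_zero_of_isMinNormControl h.2.2.2 hv⟩,
      hadm.npBangBang_of_T1_le h.2.2.2⟩
  · exact ⟨h4.npBangBang h3 hadm h.1.1.1 h.2.2.2, hadm.not_isMinNormControl_zero h.2.2.2⟩
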